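/- Let $p$ be a prime, let $E$ be a sequentially complete, Hausdorff, locally convex topological vector space over $\mathbb{Q}_p$ (the open $\mathbb{Z}_p$-submodules form a basis of $0$-neighbourhoods), let $\ell\ge 1$, $n_1,\dots,n_\ell\ge 1$, $n=n_1+\dots+n_\ell$, and $\alpha\in(\mathbb{N}_0\cup\{\infty\})^\ell$. Let $N_\alpha$ be the set of all $\beta=(\beta_1,\dots,\beta_\ell)\in\mathbb{N}_0^{n_1}\times\cdots\times\mathbb{N}_0^{n_\ell}=\mathbb{N}_0^n$ with $|\beta_j|\le\alpha_j$ for all $j\in\{1,\dots,\ell\}$. **Definitions.** A set $V\subseteq\mathbb{Q}_p^n$ is *cartesian* if $V=V_1\times\cdots\times V_n$ with sets $V_i\subseteq\mathbb{Q}_p$ without isolated points. For $\beta\in\mathbb{N}_0^n$ let $V^{\langle\beta\rangle}$ be the set of all $x=(x^{(i)}_j)_{1\le i\le n,\,0\le j\le\beta_i}$ in $\mathbb{Q}_p^{n+|\beta|}$ with $(x^{(1)}_{j_1},\dots,x^{(n)}_{j_n})\in V$ for all $0\le j_i\le\beta_i$, and let $V^{\rangle\beta\langle}$ be the set of those $x\in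 V^{\langle\beta\rangle}$ for which $x^{(i)}_j\ne x^{(i)}_k$ for all $i$ and $j\neq k$. For $g\colon V\to E$ define on $V^{\rangle\beta\langle}$ $$g^{\rangle\beta\langle}(x)=\sum_{j_1=0}^{\beta_1}\cdots\sum_{j_n=0}^{\beta_n}\Big(\prod_{i=1}^n\prod_{k\ne j_i}\frac{1}{x^{(i)}_{j_i}-x^{(i)}_{k}}\Big)\,g(x^{(1)}_{j_1},\dots,x^{(n)}_{j_n}).$$ For $\beta\in\mathbb{N}_0^n$, a function $f\colon\mathbb{Z}_p^n\to E$ is $C^\beta$ if for each cartesian, relatively open $V\subseteq\mathbb{Z}_p^n$ and each $\gamma\in\mathbb{N}_0^n$ with $\gamma\le\beta$ the map $(f|_V)^{\rangle\gamma\langle}$ has a continuous extension $(f|_V)^{\langle\gamma\rangle}\colon V^{\langle\gamma\rangle}\to E$. The space $C^\beta(\mathbb{Z}_p^n,E)$ of these functions carries the initial topology with respect to the maps $f\mapsto (f|_V)^{\langle\gamma\rangle}\in C(V^{\langle\gamma\rangle},E)$ for all such $V$ and $\gamma$ (compact-open topology on the right). A function is $C^\alpha$ if it is $C^\beta$ for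 all $\beta\in N_\alpha$, and $C^\alpha(\mathbb{Z}_p^n,E)=\bigcap_{\beta\in N_\alpha}C^\beta(\mathbb{Z}_p^n,E)$ carries the initial topology with respect to the inclusions into the spaces $C^\beta(\mathbb{Z}_p^n,E)$, $\beta\in N_\alpha$. The Mahler coefficients of $f\colon\mathbb{Z}_p^n\to E$ are $$a_\nu(f)=\sum_{\mu\le\nu}(-1)^{|\nu|-|\mu|}\binom{\nu}{\mu}f(\mu),\qquad \nu\in\mathbb{N}_0^n,\quad \binom{\nu}{\mu}=\prod_{i=1}^n\binom{\nu_i}{\mu_i}.$$ A seminorm $q$ on $E$ is *ultrametric* if $q(x+y)\le\max\{q(x),q(y)\}$. Write $\nu^\beta=\nu_1^{\beta_1}\cdots\nu_n^{\beta_n}$ (with $0^0=1$), $w_\beta\colon\mathbb{N}_0^n\to[0,\infty[$, $w_\beta(\nu)=\nu^\beta$, and $\mathcal{W}_\alpha=\{w_\beta:\beta\in N_\alpha\}$. Let $c_0(\mathbb{N}_0^n,\mathcal{W}_\alpha,E)$ be the space of all $b\colon\mathbb{N}_0^n\to E$ such that for all $w\in\mathcal{W}_\alpha$, all continuous ultrametric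 seminorms $q$ on $E$ and all $\varepsilon>0$ one has $w(\nu)q(b_\nu)<\varepsilon$ for all but finitely many $\nu$, with the vector topology defined by the seminorms $\|b\|_{w,q}=\sup_\nu w(\nu)q(b_\nu)$. **Proposition.** A continuous function $f\colon\mathbb{Z}_p^n\to E$ is $C^\alpha$ if and only if $$q(a_\nu(f))\,\nu^\beta\to 0\quad\text{as } |\nu|\to\infty$$ for each $\beta\in N_\alpha$ and each continuous ultrametric seminorm $q$ on $E$. Moreover, the map $$C^\alpha(\mathbb{Z}_p^n,E)\to c_0(\mathbb{N}_0^n,\mathcal{W}_\alpha,E),\qquad f\mapsto(a_\nu(f))_{\nu\in\mathbb{N}_0^n},$$ is an isomorphism of topological vector spaces. -/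

import Mathlib

open Filter Topology
open scoped NNReal

noncomputable section

/-! ### Partial difference quotients and `C^α`-maps

The coordinates of `K^n` are indexed by a finite type `ι`; `E` is a topological vector space
over the topological field `K`. -/

section DifferenceQuotients

variable {K : Type*} {ι : Type*}

/-- A subset of `K^ι` is cartesian if it is a product of subsets of `K` without isolated points. -/
def IsCartesian [TopologicalSpace K] (V : Set (ι → K)) : Prop :=
  ∃ W : ι → Set K, (∀ i, Preperfect (W i)) ∧ V = Set.univ.pi W

/-- The relatively open cartesian subsets of `U`. -/
structure CartesianOpen [TopologicalSpace K] (U : Set (ι → K)) where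
  carrier : Set (ι → K)
  subset : carrier ⊆ U
  isOpen : IsOpen ((↑) ⁻¹' carrier : Set U)
  isCartesian : IsCartesian carrier

/-- The set `U^{<β>}` of all `x = (x^{(i)}_j)`, `0 ≤ j ≤ β_i`, such that
`(x^{(i)}_{j_i})_i ∈ U` for all choices of the `j_i`. -/
def dqDomain (U : Set (ι → K)) (β : ι → ℕ) : Set ((i : ι) → Fin (β i + 1) → K) :=
  {x | ∀ j : (i : ι) → Fin (β i + 1), (fun i => x i (j i)) ∈ U}

/-- The subset `U^{>β<}` of `U^{<β>}`: for each `i`, the entries `x^{(i)}_j` are pairwise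
distinct. -/
def dqOffDiag (U : Set (ι → K)) (β : ι → ℕ) : Set (dqDomain U β) :=
  {x | ∀ i, Function.Injective (x.1 i)}

variable {E : Type*}

/-- The iterated partial difference quotient `f^{>β<}`; it is only used on `U^{>β<}`. -/
def diffQuot [Fintype ι] [DecidableEq ι] [Field K] [AddCommGroup E] [Module K E]
    {U : Set (ι → K)} (f : U → E) (β : ι → ℕ) (x : dqDomain U β) : E :=
  ∑ j : (i : ι) → Fin (β i + 1),
    (∏ i, ∏ k ∈ Finset.univ.erase (j i), (x.1 i (j i) - x.1 i k)⁻¹) •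
      f ⟨fun i => x.1 i (j i), x.2 j⟩

variable [Fintype ι] [DecidableEq ι] [Field K] [AddCommGroup E] [Module K E]

theorem diffQuot_add {U : Set (ι → K)} (f g : U → E) (β : ι → ℕ) (x : dqDomain U β) :
    diffQuot (f + g) β x = diffQuot f β x + diffQuot g β x := by
  simp [diffQuot, smul_add, Finset.sum_add_distrib]

theorem diffQuot_smul {U : Set (ι → K)} (c : K) (f : U → E) (β : ι → ℕ) (x : dqDomain U β) :
    diffQuot (c • f) β x = c • diffQuot f β x := by
  simp only [diffQuot, Pi.smul_apply, Finset.smul_sum]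
  exact Finset.sum_congr rfl fun j _ => smul_comm _ _ _

theorem diffQuot_zero {U : Set (ι → K)} (β : ι → ℕ) (x : dqDomain U β) :
    diffQuot (0 : U → E) β x = 0 := by
  simp [diffQuot]

variable [TopologicalSpace K] [TopologicalSpace E]

/-- `g` is a continuous extension `f^{<β>} : U^{<β>} → E` of `f^{>β<}`. -/
def IsDQExtension {U : Set (ι → K)} (f : U → E) (β : ι → ℕ) (g : C(dqDomain U β, E)) : Prop :=
  ∀ x ∈ dqOffDiag U β, g x = diffQuot f β x

/-- `f : U → E` (with `U` locally cartesian) is `C^α`, where `α ∈ (ℕ₀ ∪ {∞})^ι`: for every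
relatively open cartesian `V ⊆ U` and every `β ∈ ℕ₀^ι` with `β ≤ α`, the map `(f|_V)^{>β<}` has a
continuous extension to `V^{<β>}`. -/
def IsCAlpha {U : Set (ι → K)} (α : ι → ℕ∞) (f : U → E) : Prop :=
  ∀ (V : CartesianOpen U) (β : ι → ℕ), (∀ i, (β i : ℕ∞) ≤ α i) →
    ∃ g, IsDQExtension (f ∘ Set.inclusion V.subset) β g

variable [ContinuousAdd E] [ContinuousConstSMul K E]

/-- The `C^α`-maps `U → E`, as a linear subspace of the space of all functions `U → E`. -/
def cAlphaSubmodule (U : Set (ι → K)) (E : Type*) [AddCommGroup E] [Module K E]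
    [TopologicalSpace E] [ContinuousAdd E] [ContinuousConstSMul K E] (α : ι → ℕ∞) :
    Submodule K (U → E) where
  carrier := {f | IsCAlpha α f}
  zero_mem' := fun V β _ => ⟨0, fun x _ => (diffQuot_zero β x).symm⟩
  add_mem' := by
    intro f g hf hg V β hβ
    obtain ⟨F, hF⟩ := hf V β hβ
    obtain ⟨G, hG⟩ := hg V β hβ
    refine ⟨F + G, fun x hx => ?_⟩
    rw [ContinuousMap.add_apply, hF x hx, hG x hx, ← diffQuot_add]
    rfl
  smul_mem' := by
    intro c f hf V β hβ
    obtain ⟨F, hF⟩ := hf V β hβ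
    refine ⟨c • F, fun x hx => ?_⟩
    rw [ContinuousMap.smul_apply, hF x hx, ← diffQuot_smul]
    rfl

/-- The space `C^α(U, E)`. It is a type of its own, so that it does not inherit the topology of
pointwise convergence. -/
def CAlphaSpace (U : Set (ι → K)) (E : Type*) [AddCommGroup E] [Module K E]
    [TopologicalSpace E] [ContinuousAdd E] [ContinuousConstSMul K E] (α : ι → ℕ∞) : Type _ :=
  cAlphaSubmodule U E α

/-- The map `f ↦ (f|_V)^{<β>}` on `C^α(U, E)`. (If `E` is Hausdorff and `K` is a non-discrete
topological field, then the continuous extension is unique, as `V^{>β<}` is dense in `V^{<β>}`.) -/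
def cAlphaDelta {U : Set (ι → K)} {α : ι → ℕ∞} (V : CartesianOpen U)
    (β : {β : ι → ℕ // ∀ i, (β i : ℕ∞) ≤ α i}) (f : CAlphaSpace U E α) :
    C(dqDomain V.carrier β.1, E) :=
  (f.2 V β.1 β.2).choose

/-- The compact-open `C^α`-topology: the initial topology with respect to the maps
`f ↦ (f|_V)^{<β>}` into the spaces `C(V^{<β>}, E)` with the compact-open topology. -/
instance (U : Set (ι → K)) (α : ι → ℕ∞) : TopologicalSpace (CAlphaSpace U E α) :=
  ⨅ (V : CartesianOpen U) (β : {β : ι → ℕ // ∀ i, (β i : ℕ∞) ≤ α i}),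
    TopologicalSpace.induced (cAlphaDelta V β) ContinuousMap.compactOpen

end DifferenceQuotients

/-! ### `C^α`-maps on subsets of `K^{n_1} × ⋯ × K^{n_ℓ}` for `α ∈ (ℕ₀ ∪ {∞})^ℓ`

The coordinates are indexed by pairs `⟨j, k⟩` with `j < ℓ`, `k < n_j`. -/

section Blocks

/-- The set `N_α` of all `β ∈ ℕ₀^{n_1} × ⋯ × ℕ₀^{n_ℓ}` with `|β_j| ≤ α_j` for all `j`. -/
def blockIndices {l : ℕ} (n : Fin l → ℕ) (α : Fin l → ℕ∞) : Set ((Σ j, Fin (n j)) → ℕ) :=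
  {β | ∀ j, ((∑ k, β ⟨j, k⟩ : ℕ) : ℕ∞) ≤ α j}

variable {K : Type*} {l : ℕ} {n : Fin l → ℕ} [Field K] [TopologicalSpace K]

/-- `f : U → E` is `C^α`, with `α ∈ (ℕ₀ ∪ {∞})^ℓ`, if it is `C^β` for all `β ∈ N_α`. -/
def IsBlockCAlpha {E : Type*} [AddCommGroup E] [Module K E] [TopologicalSpace E]
    {U : Set ((Σ j, Fin (n j)) → K)} (α : Fin l → ℕ∞) (f : U → E) : Prop :=
  ∀ β ∈ blockIndices n α, IsCAlpha (fun i => (β i : ℕ∞)) f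

/-- `C^α(U, E) = ⋂_{β ∈ N_α} C^β(U, E)` as a linear subspace of the space of all functions. -/
def blockCAlphaSubmodule (U : Set ((Σ j, Fin (n j)) → K)) (E : Type*) [AddCommGroup E]
    [Module K E] [TopologicalSpace E] [ContinuousAdd E] [ContinuousConstSMul K E]
    (α : Fin l → ℕ∞) : Submodule K (U → E) where
  carrier := {f | IsBlockCAlpha α f}
  zero_mem' := fun β _ => (cAlphaSubmodule U E fun i => (β i : ℕ∞)).zero_mem
  add_mem' := fun hf hg β hβ =>
    (cAlphaSubmodule U E fun i => (β i : ℕ∞)).add_mem (hf β hβ) (hg β hβ)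
  smul_mem' := fun c _ hf β hβ =>
    (cAlphaSubmodule U E fun i => (β i : ℕ∞)).smul_mem c (hf β hβ)

variable (U : Set ((Σ j, Fin (n j)) → K)) (E : Type*) [AddCommGroup E]
    [Module K E] [TopologicalSpace E] [ContinuousAdd E] [ContinuousConstSMul K E]
    (α : Fin l → ℕ∞)

/-- The space `C^α(U, E)` for `α ∈ (ℕ₀ ∪ {∞})^ℓ`. -/
def BlockCAlphaSpace : Type _ := blockCAlphaSubmodule U E α

instance : AddCommGroup (BlockCAlphaSpace U E α) :=
  inferInstanceAs (AddCommGroup (blockCAlphaSubmodule U E α))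

instance : Module K (BlockCAlphaSpace U E α) :=
  inferInstanceAs (Module K (blockCAlphaSubmodule U E α))

instance : CoeFun (BlockCAlphaSpace U E α) (fun _ => U → E) := ⟨fun f => f.1⟩

variable {U E α}

/-- The inclusion `C^α(U, E) → C^β(U, E)` for `β ∈ N_α`. -/
def BlockCAlphaSpace.incl (β : blockIndices n α) (f : BlockCAlphaSpace U E α) :
    CAlphaSpace U E (fun i => (β.1 i : ℕ∞)) :=
  ⟨f.1, f.2 β.1 β.2⟩

variable (U E α)

/-- The compact-open `C^α`-topology: the initial topology with respect to the inclusion maps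
`C^α(U, E) → C^β(U, E)`, `β ∈ N_α`. -/
instance : TopologicalSpace (BlockCAlphaSpace U E α) :=
  ⨅ β : blockIndices n α, TopologicalSpace.induced (BlockCAlphaSpace.incl β) inferInstance

end Blocks

/-! ### Locally convex spaces and weighted `c_0`-spaces -/

section LocallyConvex

variable (K : Type*) [NormedField K] (E : Type*) [AddCommGroup E] [Module K E]
  [TopologicalSpace E]

/-- A topological vector space `E` over an ultrametric field `K` is locally convex if the open
`𝕆`-submodules of `E` form a basis of `0`-neighbourhoods, where `𝕆 = {c : ‖c‖ ≤ 1}`. -/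
def IsUltraLocallyConvex : Prop :=
  (𝓝 (0 : E)).HasBasis
    (fun S : AddSubgroup E => IsOpen (S : Set E) ∧ ∀ c : K, ‖c‖ ≤ 1 → ∀ x ∈ S, c • x ∈ S)
    (fun S => (S : Set E))

/-- The continuous ultrametric seminorms on `E`. -/
def CtsUltraSeminorm : Type _ :=
  {q : Seminorm K E // Continuous q ∧ IsNonarchimedean q}

variable {X : Type*} (W : Set (X → ℝ≥0))

/-- The space `c_0(X, W, E)`, for a set `W` of weights on `X`, as a linear subspace of the space of
all functions: for all `w ∈ W`, all continuous ultrametric seminorms `q` and all `ε > 0`, one has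
`w x * q (f x) < ε` for all `x` outside some finite set. -/
def c0Submodule : Submodule K (X → E) where
  carrier := {f | ∀ w ∈ W, ∀ q : CtsUltraSeminorm K E, ∀ ε : ℝ, 0 < ε →
    ∃ Φ : Finset X, ∀ x ∉ Φ, (w x : ℝ) * q.1 (f x) < ε}
  zero_mem' := fun w _ q ε hε => ⟨∅, fun x _ => by simpa using hε⟩
  add_mem' := by
    classical
    intro f g hf hg w hw q ε hε
    obtain ⟨Φ, hΦ⟩ := hf w hw q (ε / 2) (half_pos hε)
    obtain ⟨Ψ, hΨ⟩ := hg w hw q (ε / 2) (half_pos hε)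
    refine ⟨Φ ∪ Ψ, fun x hx => ?_⟩
    rw [Finset.notMem_union] at hx
    have h1 := hΦ x hx.1
    have h2 := hΨ x hx.2
    calc (w x : ℝ) * q.1 (f x + g x) ≤ (w x : ℝ) * (q.1 (f x) + q.1 (g x)) :=
          mul_le_mul_of_nonneg_left (map_add_le_add _ _ _) (w x).2
      _ < ε := by linarith
  smul_mem' := by
    intro c f hf w hw q ε hε
    have hc : 0 < ‖c‖ + 1 := by positivity
    obtain ⟨Φ, hΦ⟩ := hf w hw q (ε / (‖c‖ + 1)) (div_pos hε hc)
    refine ⟨Φ, fun x hx => ?_⟩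
    have h1 := (lt_div_iff₀ hc).1 (hΦ x hx)
    have h2 : 0 ≤ (w x : ℝ) * q.1 (f x) := mul_nonneg (w x).2 (apply_nonneg _ _)
    change (w x : ℝ) * q.1 (c • f x) < ε
    rw [map_smul_eq_mul]
    nlinarith

/-- The space `c_0(X, W, E)`. It is a type of its own, so that it does not inherit the topology of
pointwise convergence. -/
def C0Space : Type _ := c0Submodule K E W

instance : AddCommGroup (C0Space K E W) := inferInstanceAs (AddCommGroup (c0Submodule K E W))

instance : Module K (C0Space K E W) := inferInstanceAs (Module K (c0Submodule K E W))

instance : CoeFun (C0Space K E W) (fun _ => X → E) := ⟨fun f => f.1⟩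

variable {K E W}

theorem C0Space.bddAbove (w : W) (q : CtsUltraSeminorm K E) (f : C0Space K E W) :
    BddAbove (Set.range fun x => (w.1 x : ℝ) * q.1 (f x)) := by
  obtain ⟨Φ, hΦ⟩ := f.2 w.1 w.2 q 1 one_pos
  refine ⟨1 + ∑ x ∈ Φ, (w.1 x : ℝ) * q.1 (f x), ?_⟩
  have hpos : ∀ x, 0 ≤ (w.1 x : ℝ) * q.1 (f x) :=
    fun x => mul_nonneg (w.1 x).2 (apply_nonneg _ _)
  rintro _ ⟨x, rfl⟩
  by_cases hx : x ∈ Φ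
  · have := Finset.single_le_sum (fun y _ => hpos y) hx
    linarith
  · have h1 := hΦ x hx
    have h2 := Finset.sum_nonneg (s := Φ) (fun y _ => hpos y)
    linarith

/-- The seminorm `‖f‖_{w,q} = sup_x w x * q (f x)` on `c_0(X, W, E)`. -/
def C0Space.seminorm (w : W) (q : CtsUltraSeminorm K E) : Seminorm K (C0Space K E W) :=
  Seminorm.of (fun f => ⨆ x, (w.1 x : ℝ) * q.1 (f x))
    (by
      intro f g
      have hpos : ∀ (h : C0Space K E W) (x : X), 0 ≤ (w.1 x : ℝ) * q.1 (h x) :=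
        fun h x => mul_nonneg (w.1 x).2 (apply_nonneg _ _)
      refine Real.iSup_le (fun x => ?_)
        (add_nonneg (Real.iSup_nonneg (hpos f)) (Real.iSup_nonneg (hpos g)))
      calc (w.1 x : ℝ) * q.1 (f x + g x)
          ≤ (w.1 x : ℝ) * (q.1 (f x) + q.1 (g x)) :=
            mul_le_mul_of_nonneg_left (map_add_le_add _ _ _) (w.1 x).2
        _ = (w.1 x : ℝ) * q.1 (f x) + (w.1 x : ℝ) * q.1 (g x) := mul_add _ _ _
        _ ≤ _ := add_le_add (le_ciSup (C0Space.bddAbove w q f) x)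
            (le_ciSup (C0Space.bddAbove w q g) x))
    (by
      intro c f
      rw [Real.mul_iSup_of_nonneg (norm_nonneg c)]
      refine congrArg _ (funext fun x => ?_)
      change (w.1 x : ℝ) * q.1 (c • f x) = _
      rw [map_smul_eq_mul]
      ring)

variable (K E W)

/-- The vector topology on `c_0(X, W, E)` defined by the seminorms `‖·‖_{w,q}`. -/
instance : TopologicalSpace (C0Space K E W) :=
  SeminormFamily.moduleFilterBasis (𝕜 := K)
    (fun i : W × CtsUltraSeminorm K E => C0Space.seminorm i.1 i.2) |>.topology

end LocallyConvex

/-! ### Mahler coefficients -/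

section Mahler

/-- `ℤ_p^ι` as a subset of `ℚ_p^ι`. -/
def zpPow (p : ℕ) [Fact p.Prime] (ι : Type*) : Set (ι → ℚ_[p]) :=
  {x | ∀ i, x i ∈ PadicInt.subring p}

/-- The point `μ ∈ ℕ₀^ι` of `ℤ_p^ι`. -/
def natPoint (p : ℕ) [Fact p.Prime] {ι : Type*} (μ : ι → ℕ) : zpPow p ι :=
  ⟨fun i => (μ i : ℚ_[p]), fun i => natCast_mem (PadicInt.subring p) (μ i)⟩

variable {p : ℕ} [Fact p.Prime] {ι : Type*} [Fintype ι] [DecidableEq ι]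
  {E : Type*} [AddCommGroup E]

/-- The Mahler coefficient
`a_ν(f) = ∑_{μ ≤ ν} (-1)^{|ν| - |μ|} (ν choose μ) f(μ)` of `f : ℤ_p^ι → E`. -/
def mahlerCoeff (f : zpPow p ι → E) (ν : ι → ℕ) : E :=
  ∑ μ ∈ Finset.Iic ν,
    ((-1 : ℤ) ^ (∑ i, ν i - ∑ i, μ i) * ∏ i, ((ν i).choose (μ i) : ℤ)) • f (natPoint p μ)

/-- The weight `w_β(ν) = ν^β` on `ℕ₀^ι` (with `0^0 = 1`). -/
def powWeight (β : ι → ℕ) (ν : ι → ℕ) : ℝ≥0 := ∏ i, (ν i : ℝ≥0) ^ β i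

/-- The filter on `ℕ₀^ι` that expresses `|ν| → ∞`, where `|ν| = ∑ i, ν i`. -/
def absAtTop (ι : Type*) [Fintype ι] : Filter (ι → ℕ) :=
  comap (fun ν => ∑ i, ν i) atTop

end Mahler

end

/-! The proof rests on an explicit form of the extended difference quotients of binomial
coefficients. Write the `k + 1` nodes of one coordinate as y₀, y₀+1+y₁, y₀+1+y₁+1+y₂, ….
Vandermonde's identity and (j+1)·C(z+1,j+1) = (z+1)·C(z,j) cancel the denominators node by node. The
`k`-th divided difference of x ↦ C(x,m) thus becomes a polynomial in y (`binomDQ`,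
`divDiff_choose`): the sum over all κ with |κ| + k = m of c_κ ∏ C(y_l,κ_l). Here c_κ (`stepCoeff`)
is a product of inverses of `k` positive integers not exceeding m. Since ‖1/j‖ ≤ j, the polynomial
is bounded by m^k on all of ℤ_p^(k+1), diagonal included (`norm_binomDQ_le`).

Decay implies smoothness: by this bound, a Mahler series with weighted null coefficients may be
differenced term by term, and the resulting series converges uniformly to a continuous extension
(`WeightedNull.dqSum`). A continuous f whose coefficients decay equals the sum of its Mahler series,
since both functions take the same values at the dense set of natural points.

Smoothness implies decay: in step coordinates, an extended quotient of f is a continuous function on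
a compact power of ℤ_p, so its Newton coefficients tend to 0 (`finite_newtonCoeff_ge`). At natural y
the nodes are distinct, so these coefficients can be computed from f: they are (∏ c_κ)·a_ν(f) with
ν_i = |κ_i| + γ_i (`newtonCoeff_dqExtension`). For each ν there are γ ≤ β and κ for which the
factors of c_κ are inverses of large powers of p, giving ‖∏ c_κ‖ ≥ C ν^β (`exists_le_stepCoeff`).

Both estimates hold with constants independent of f, so they also give continuity of the Mahler map
and of its inverse. Of N_α, only two properties matter: it contains 0 and it is closed downwards. -/

noncomputable section

/-! ### Newton coefficients in one variable -/

section Newton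

/-- The matrix entries of the inverse binomial transform. -/
def newtonSign (a b : ℕ) : ℤ := (-1) ^ (a - b) * (a.choose b : ℤ)

theorem newtonSign_eq_zero {a b : ℕ} (h : a < b) : newtonSign a b = 0 := by
  simp [newtonSign, Nat.choose_eq_zero_of_lt h]

theorem fwdDiff_eq_sum_newtonSign {G : Type*} [AddCommGroup G] (f : ℕ → G) (a : ℕ) :
    (fwdDiff 1)^[a] f 0 = ∑ b ∈ Finset.Iic a, newtonSign a b • f b := by
  rw [fwdDiff_iter_eq_sum_shift]
  refine Finset.sum_congr (by ext; simp) fun b _ => ?_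
  simp [newtonSign]

theorem sum_newtonSign_mul_choose (a c : ℕ) :
    ∑ b ∈ Finset.Iic a, newtonSign a b * (b.choose c : ℤ) = if a = c then 1 else 0 := by
  have := fwdDiff_eq_sum_newtonSign (fun x => (x.choose c : ℤ)) a
  rw [fwdDiff_iter_choose_zero] at this
  simpa [eq_comm] using this.symm

/-- Newton's forward difference formula for the indicator of `b`; summands with `c > x` vanish. -/
theorem sum_choose_mul_newtonSign {M x : ℕ} (hx : x ≤ M) (b : ℕ) :
    ∑ c ∈ Finset.Iic M, (x.choose c : ℤ) * newtonSign c b = if x = b then 1 else 0 := by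
  have h := shift_eq_sum_fwdDiff_iter (1 : ℕ) (fun y => if y = b then (1 : ℤ) else 0) x 0
  simp only [smul_eq_mul, mul_one, zero_add, nsmul_eq_mul] at h
  rw [h]
  have hsub : Finset.range (x + 1) ⊆ Finset.Iic M := fun c hc => by
    simp at hc ⊢; omega
  rw [← Finset.sum_subset hsub]
  · refine Finset.sum_congr rfl fun c _ => ?_
    rw [fwdDiff_eq_sum_newtonSign]
    congr 1
    by_cases hb : b ≤ c
    · simp [hb]
    · rw [newtonSign_eq_zero (not_le.1 hb)]
      exact (Finset.sum_eq_zero fun d hd => by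
        rw [if_neg (by simp at hd; omega), smul_zero]).symm
  · intro c _ hc
    rw [Nat.choose_eq_zero_of_lt (by simp at hc; omega)]
    simp

end Newton

/-! ### Divided differences -/

section DividedDifference

variable {K : Type*} [Field K]

/-- The divided difference with nodes `x` and values `v`. -/
def divDiff {k : ℕ} (x v : Fin k → K) : K :=
  ∑ j, (∏ l ∈ Finset.univ.erase j, (x j - x l)⁻¹) * v j

theorem divDiff_sum {k : ℕ} {ι : Type*} (s : Finset ι) (x : Fin k → K) (c : ι → K)
    (v : ι → Fin k → K) :
    divDiff x (fun j => ∑ i ∈ s, c i * v i j) = ∑ i ∈ s, c i * divDiff x (v i) := by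
  simp only [divDiff, Finset.mul_sum]
  rw [Finset.sum_comm]
  exact Finset.sum_congr rfl fun i _ => Finset.sum_congr rfl fun j _ => by ring

theorem divDiff_add_left {k : ℕ} (c : K) (x v : Fin k → K) :
    divDiff (fun j => c + x j) v = divDiff x v := by
  simp [divDiff]

theorem divDiff_zero_right {k : ℕ} (x : Fin k → K) : divDiff x (fun _ => 0) = 0 := by
  simp [divDiff]

/-- By Lagrange interpolation the sum is the coefficient of degree `k + 1` of the constant
polynomial 1. -/
theorem divDiff_one (k : ℕ) {x : Fin (k + 2) → K} (hx : Function.Injective x) :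
    ∑ j, ∏ l ∈ Finset.univ.erase j, (x j - x l)⁻¹ = 0 := by
  have h := Lagrange.coeff_eq_sum (s := Finset.univ) (v := x) hx.injOn (P := 1)
    (by simp only [Polynomial.degree_one, Finset.card_univ, Fintype.card_fin]
        exact_mod_cast Nat.succ_pos _)
  simp only [Polynomial.eval_one, one_div, ← Finset.prod_inv_distrib] at h
  rw [← h, Polynomial.coeff_one]
  simp

theorem prod_erase_succ {k : ℕ} (j : Fin (k + 1)) (F : Fin (k + 2) → K) :
    ∏ l ∈ Finset.univ.erase j.succ, F l = F 0 * ∏ l ∈ Finset.univ.erase j, F l.succ := by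
  have : (Finset.univ.erase j.succ : Finset (Fin (k + 2))) =
      Finset.cons 0 ((Finset.univ.erase j).map (Fin.succEmb _)) (by simp) := by
    ext l
    refine Fin.cases ?_ (fun l => ?_) l
    · simp [(Fin.succ_ne_zero j).symm]
    · simp
  rw [this, Finset.prod_cons, Finset.prod_map]
  rfl

/-- By `divDiff_one`, subtracting `v 0` from all values changes nothing, and every remaining term
contains the factor `(x j.succ - x 0)⁻¹`. Peeling off the first node in this way drives the
recursion for `binomDQ`. -/
theorem divDiff_succ {k : ℕ} {x : Fin (k + 2) → K} (hx : Function.Injective x)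
    (v : Fin (k + 2) → K) :
    divDiff x v = divDiff (Fin.tail x)
      (fun j => (x j.succ - x 0)⁻¹ * (v j.succ - v 0)) := by
  have h1 := divDiff_one k hx
  rw [Fin.sum_univ_succ] at h1
  simp only [divDiff]
  rw [Fin.sum_univ_succ, eq_neg_of_add_eq_zero_left h1, neg_mul, Finset.sum_mul,
    ← Finset.sum_neg_distrib, ← Finset.sum_add_distrib]
  refine Finset.sum_congr rfl fun j _ => ?_
  rw [prod_erase_succ]
  simp only [Fin.tail]
  ring

end DividedDifference

/-! ### Step coordinates -/

section StepCoordinates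

/-- The points `y₀, y₀ + 1 + y₁, y₀ + 1 + y₁ + 1 + y₂, …`. -/
def stepPoints {R : Type*} [Semiring R] : (k : ℕ) → (Fin (k + 1) → R) → Fin (k + 1) → R
  | 0, y => y
  | k + 1, y => Fin.cons (y 0) fun l => y 0 + 1 + stepPoints k (Fin.tail y) l

/-- The inverse of `stepPoints`. -/
def stepDiffs {R : Type*} [Ring R] : (k : ℕ) → (Fin (k + 1) → R) → Fin (k + 1) → R
  | 0, x => x
  | k + 1, x => Fin.cons (x 0) (stepDiffs k fun l => x l.succ - x 0 - 1)

theorem stepPoints_stepDiffs {R : Type*} [Ring R] (k : ℕ) (x : Fin (k + 1) → R) :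
    stepPoints k (stepDiffs k x) = x := by
  induction k with
  | zero => rfl
  | succ k ih =>
    simp only [stepPoints, stepDiffs, Fin.cons_zero, Fin.tail_cons, ih]
    funext l
    refine Fin.cases rfl (fun l => ?_) l
    simp

theorem stepPoints_natCast {R : Type*} [Semiring R] (k : ℕ) (y : Fin (k + 1) → ℕ) :
    stepPoints k (fun l => (y l : R)) = fun l => ((stepPoints (R := ℕ) k y l : ℕ) : R) := by
  induction k with
  | zero => rfl
  | succ k ih =>
    funext l
    refine Fin.cases rfl (fun l => ?_) l
    have := congrFun (ih (Fin.tail y)) l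
    simp only [stepPoints, Fin.cons_succ, Nat.cast_add, Nat.cast_one, ← this]
    rfl

/-- The summands 1 in the steps separate the nodes, so natural step coordinates always give points
off the diagonal, where an extension is determined by f. -/
theorem strictMono_stepPoints (k : ℕ) (y : Fin (k + 1) → ℕ) : StrictMono (stepPoints k y) := by
  induction k with
  | zero => exact fun a b h => absurd (Subsingleton.elim (α := Fin 1) a b) h.ne
  | succ k ih =>
    refine Fin.strictMono_iff_lt_succ.2 fun i => ?_
    refine Fin.cases ?_ (fun j => ?_) i
    · simp [stepPoints]; omega
    · have := ih (Fin.tail y) (Fin.castSucc_lt_succ (i := j))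
      simp only [stepPoints, ← Fin.succ_castSucc, Fin.cons_succ]
      omega

theorem continuous_stepPoints {R : Type*} [Semiring R] [TopologicalSpace R] [ContinuousAdd R]
    (k : ℕ) : Continuous (stepPoints k : (Fin (k + 1) → R) → _) := by
  induction k with
  | zero => exact continuous_id
  | succ k ih =>
    have h : Continuous fun y : Fin (k + 2) → R => Fin.tail y :=
      continuous_pi fun l => continuous_apply l.succ
    refine continuous_pi fun l => ?_
    refine Fin.cases (continuous_apply 0) (fun l => ?_) l
    exact ((continuous_apply 0).add continuous_const).add
      ((continuous_apply l).comp (ih.comp h))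

theorem continuous_stepDiffs {R : Type*} [Ring R] [TopologicalSpace R] [IsTopologicalRing R]
    (k : ℕ) : Continuous (stepDiffs k : (Fin (k + 1) → R) → _) := by
  induction k with
  | zero => exact continuous_id
  | succ k ih =>
    have h : Continuous fun x : Fin (k + 2) → R => fun l : Fin (k + 1) => x l.succ - x 0 - 1 := by
      fun_prop
    refine continuous_pi fun l => ?_
    refine Fin.cases (continuous_apply 0) (fun l => ?_) l
    exact (continuous_apply l).comp (ih.comp h)

end StepCoordinates

/-! ### Divided differences of binomial coefficients -/

section BinomDQ

variable {p : ℕ} [Fact p.Prime]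

/-- The `k`-th divided difference of `x ↦ x.choose m`, in step coordinates. -/
def binomDQ : (k m : ℕ) → (Fin (k + 1) → ℤ_[p]) → ℚ_[p]
  | 0, m, y => (Ring.choose (y 0) m : ℤ_[p])
  | _ + 1, 0, _ => 0
  | k + 1, m + 1, y => ∑ ij ∈ Finset.HasAntidiagonal.antidiagonal m,
      ((Ring.choose (y 0) ij.1 : ℤ_[p]) * ((ij.2 + 1 : ℕ) : ℚ_[p])⁻¹) *
        binomDQ k ij.2 (Fin.tail y)

theorem continuous_binomDQ (k m : ℕ) : Continuous (binomDQ (p := p) k m) := by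
  have hc : ∀ (k m : ℕ), Continuous fun y : Fin (k + 1) → ℤ_[p] =>
      ((Ring.choose (y 0) m : ℤ_[p]) : ℚ_[p]) := fun k m =>
    continuous_subtype_val.comp ((PadicInt.continuous_choose m).comp (continuous_apply 0))
  induction k generalizing m with
  | zero => exact hc 0 m
  | succ k ih =>
    cases m with
    | zero => exact continuous_const
    | succ m =>
      have h : Continuous fun y : Fin (k + 2) → ℤ_[p] => Fin.tail y :=
        continuous_pi fun l => continuous_apply l.succ
      exact continuous_finsetSum _ fun ij _ =>
        ((hc (k + 1) ij.1).mul continuous_const).mul ((ih ij.2).comp h)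

/-- The norm is the exact power of p dividing `j + 1`. -/
theorem padic_norm_inv_natCast_succ_le (j : ℕ) :
    ‖((j + 1 : ℕ) : ℚ_[p])⁻¹‖ ≤ (j + 1 : ℕ) := by
  have h0 : (j + 1 : ℕ) ≠ 0 := Nat.succ_ne_zero j
  have hdvd : p ^ padicValNat p (j + 1) ≤ j + 1 :=
    Nat.le_of_dvd (Nat.succ_pos j) pow_padicValNat_dvd
  rw [norm_inv, Padic.norm_eq_zpow_neg_valuation (Nat.cast_ne_zero.2 h0), Padic.valuation_natCast, zpow_neg, inv_inv, zpow_natCast]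
  exact_mod_cast hdvd

/-- Binomial coefficients have norm at most 1, and each recursion step costs one factor ‖(j+1)⁻¹‖ ≤
j+1 with j+1 at most the current `m`; the ultrametric inequality makes the number of summands
irrelevant. -/
theorem norm_binomDQ_le (k m : ℕ) (y : Fin (k + 1) → ℤ_[p]) :
    ‖binomDQ k m y‖ ≤ (m : ℝ) ^ k := by
  induction k generalizing m with
  | zero => simpa [binomDQ] using PadicInt.norm_le_one (Ring.choose (y 0) m)
  | succ k ih =>
    cases m with
    | zero => simp [binomDQ]
    | succ m =>
      refine IsUltrametricDist.norm_sum_le_of_forall_le_of_nonneg (by positivity) fun ij hij => ?_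
      have hj : ij.2 ≤ m := Finset.HasAntidiagonal.antidiagonal.snd_le hij
      rw [norm_mul, norm_mul, pow_succ']
      have h1 : ‖((Ring.choose (y 0) ij.1 : ℤ_[p]) : ℚ_[p])‖ ≤ 1 := PadicInt.norm_le_one _
      have h2 := padic_norm_inv_natCast_succ_le (p := p) ij.2
      have h3 := ih ij.2 (Fin.tail y)
      have h4 : (ij.2 : ℝ) ^ k ≤ ((m + 1 : ℕ) : ℝ) ^ k :=
        pow_le_pow_left₀ (by positivity) (by exact_mod_cast hj.trans (Nat.le_succ m)) _
      have h5 : ((ij.2 + 1 : ℕ) : ℝ) ≤ (m + 1 : ℕ) := by exact_mod_cast Nat.succ_le_succ hj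
      refine mul_le_mul ?_ (h3.trans h4) (norm_nonneg _) (by positivity)
      calc _ ≤ 1 * ((ij.2 + 1 : ℕ) : ℝ) := mul_le_mul h1 h2 (norm_nonneg _) zero_le_one
        _ ≤ _ := by rwa [one_mul]

theorem succ_mul_choose_add_one {R : Type*} [CommRing R] [BinomialRing R] (z : R) (j : ℕ) :
    ((j + 1 : ℕ) : R) * Ring.choose (z + 1) (j + 1) = (z + 1) * Ring.choose z j := by
  have h := Ring.choose_smul_choose (z + 1) (n := j + 1) (k := 1) (by omega)
  simpa [nsmul_eq_mul] using h

theorem padicInt_choose_add (x z : ℤ_[p]) (m : ℕ) :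
    Ring.choose (x + (z + 1)) (m + 1) - Ring.choose x (m + 1) =
      ∑ ij ∈ Finset.HasAntidiagonal.antidiagonal m, Ring.choose x ij.1 * Ring.choose (z + 1) (ij.2 + 1) := by
  rw [Ring.add_choose_eq _ (Commute.all _ _), Finset.Nat.sum_antidiagonal_succ']
  simp

/-- After `divDiff_succ`, the slopes from the first node have denominators z+1. Vandermonde's
identity splits the increment of C(·,m+1) into terms C(y₀,i)·C(z+1,j+1), each of which absorbs that
denominator and leaves C(z,j)/(j+1). Translation invariance then reduces to fewer nodes. -/
theorem divDiff_choose (k m : ℕ) (y : Fin (k + 1) → ℤ_[p])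
    (hy : Function.Injective (stepPoints k y)) :
    divDiff (fun j => ((stepPoints k y j : ℤ_[p]) : ℚ_[p]))
      (fun j => ((Ring.choose (stepPoints k y j : ℤ_[p]) m : ℤ_[p]) : ℚ_[p])) = binomDQ k m y := by
  induction k generalizing m with
  | zero => simp [divDiff, stepPoints, binomDQ]
  | succ k ih =>
    set z := stepPoints k (Fin.tail y) with hz
    have hs : ∀ j : Fin (k + 1), stepPoints (k + 1) y j.succ = y 0 + 1 + z j := fun j => rfl
    have h0 : stepPoints (k + 1) y 0 = y 0 := rfl
    have hinj : Function.Injective z := fun a b hab => by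
      have : a.succ = b.succ := hy (by rw [hs, hs, hab])
      exact Fin.succ_injective _ this
    -- `z j + 1` is the difference between node `j.succ` and the first node.
    have hne : ∀ j, ((z j : ℤ_[p]) : ℚ_[p]) + 1 ≠ 0 := fun j h => by
      have h' : z j + 1 = 0 := Subtype.coe_injective (by push_cast; exact h)
      have : stepPoints (k + 1) y j.succ = stepPoints (k + 1) y 0 := by
        rw [hs, h0]; linear_combination h'
      exact Fin.succ_ne_zero j (hy this)
    rw [divDiff_succ (x := fun j => ((stepPoints (k + 1) y j : ℤ_[p]) : ℚ_[p]))
      fun a b h => hy (Subtype.coe_injective h)]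
    have hx : (Fin.tail fun j => ((stepPoints (k + 1) y j : ℤ_[p]) : ℚ_[p])) =
        fun j => ((y 0 : ℚ_[p]) + 1) + (z j : ℚ_[p]) := by
      funext j; simp [Fin.tail, hs]
    rw [hx, divDiff_add_left]
    cases m with
    | zero => simp [binomDQ, divDiff_zero_right]
    | succ m =>
      have hv : (fun j : Fin (k + 1) => (((stepPoints (k + 1) y j.succ : ℤ_[p]) : ℚ_[p]) -
          ((stepPoints (k + 1) y 0 : ℤ_[p]) : ℚ_[p]))⁻¹ *
          (((Ring.choose (stepPoints (k + 1) y j.succ) (m + 1) : ℤ_[p]) : ℚ_[p]) -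
            ((Ring.choose (stepPoints (k + 1) y 0) (m + 1) : ℤ_[p]) : ℚ_[p]))) =
          fun j => ∑ ij ∈ Finset.HasAntidiagonal.antidiagonal m,
            (((Ring.choose (y 0) ij.1 : ℤ_[p]) : ℚ_[p]) * ((ij.2 + 1 : ℕ) : ℚ_[p])⁻¹) *
              ((Ring.choose (z j) ij.2 : ℤ_[p]) : ℚ_[p]) := by
        funext j
        rw [hs, h0, show y 0 + 1 + z j = y 0 + (z j + 1) by ring, ← PadicInt.coe_sub,
          ← PadicInt.coe_sub, padicInt_choose_add, PadicInt.coe_sum, Finset.mul_sum]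
        refine Finset.sum_congr rfl fun ij _ => ?_
        have hj : ((ij.2 + 1 : ℕ) : ℚ_[p]) ≠ 0 := Nat.cast_ne_zero.2 (Nat.succ_ne_zero _)
        have hc : ((ij.2 + 1 : ℕ) : ℚ_[p]) * (Ring.choose (z j + 1) (ij.2 + 1) : ℤ_[p]) =
            ((z j : ℚ_[p]) + 1) * (Ring.choose (z j) ij.2 : ℤ_[p]) := by
          exact_mod_cast congrArg ((↑) : ℤ_[p] → ℚ_[p]) (succ_mul_choose_add_one (z j) ij.2)
        have hne' := hne j
        rw [add_sub_cancel_left, PadicInt.coe_add, PadicInt.coe_mul, PadicInt.coe_one]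
        rw [mul_comm, ← eq_div_iff hj] at hc
        rw [hc]
        field_simp
      rw [hv, divDiff_sum]
      simp only [binomDQ]
      exact Finset.sum_congr rfl fun ij _ => by rw [ih ij.2 (Fin.tail y) hinj]

/-- The Newton coefficients of `binomDQ k m`. -/
def stepCoeff (p : ℕ) [Fact p.Prime] : (k : ℕ) → (Fin (k + 1) → ℕ) → ℚ_[p]
  | 0, _ => 1
  | k + 1, κ => ((∑ l, Fin.tail κ l + k + 1 : ℕ) : ℚ_[p])⁻¹ * stepCoeff p k (Fin.tail κ)

theorem sum_Iic_fin_succ {G : Type*} [AddCommMonoid G] {k : ℕ} (κ : Fin (k + 1) → ℕ)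
    (F : (Fin (k + 1) → ℕ) → G) :
    ∑ lam ∈ Finset.Iic κ, F lam =
      ∑ a ∈ Finset.Iic (κ 0), ∑ mu ∈ Finset.Iic (Fin.tail κ), F (Fin.cons a mu) := by
  rw [← Finset.sum_product']
  refine Finset.sum_bij' (fun lam _ => (lam 0, Fin.tail lam)) (fun x _ => Fin.cons x.1 x.2)
    ?_ ?_ ?_ ?_ ?_
  · intro lam h
    have h := Finset.mem_Iic.1 h
    simpa using ⟨h 0, fun l => h l.succ⟩
  · intro x h
    simp only [Finset.mem_product, Finset.mem_Iic] at h ⊢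
    exact Fin.cases h.1 h.2
  · intro lam _; simp
  · intro x _; simp
  · intro lam _; simp

/-- Newton coefficients are dual to products of binomials. In the recursion, the transform in the
first variable keeps only the summand with `ij.1 = κ 0`, and induction fixes `ij.2`. -/
theorem newton_binomDQ (k m : ℕ) (κ : Fin (k + 1) → ℕ) :
    ∑ lam ∈ Finset.Iic κ, ((∏ l, newtonSign (κ l) (lam l) : ℤ) : ℚ_[p]) *
      binomDQ k m (fun l => (lam l : ℤ_[p])) =
    if ∑ l, κ l + k = m then stepCoeff p k κ else 0 := by
  have hsign : ∀ a c : ℕ, ∑ b ∈ Finset.Iic a, ((newtonSign a b : ℤ) : ℚ_[p]) *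
      ((Ring.choose (b : ℤ_[p]) c : ℤ_[p]) : ℚ_[p]) = if a = c then 1 else 0 := fun a c => by
    have := congrArg (fun z : ℤ => (z : ℚ_[p])) (sum_newtonSign_mul_choose a c)
    simpa [Ring.choose_natCast] using this
  induction k generalizing m with
  | zero =>
    rw [sum_Iic_fin_succ]
    have h1 : Finset.Iic (Fin.tail κ) = {Fin.tail κ} := by
      ext x; simp [Subsingleton.elim x (Fin.tail κ)]
    simpa [binomDQ, stepCoeff, h1] using hsign (κ 0) m
  | succ k ih =>
    cases m with
    | zero => simp [binomDQ]
    | succ m =>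
      rw [sum_Iic_fin_succ]
      have hterm : ∀ (a : ℕ) (mu : Fin (k + 1) → ℕ),
          ((∏ l, newtonSign (κ l) ((Fin.cons a mu : Fin (k + 2) → ℕ) l) : ℤ) : ℚ_[p]) *
            binomDQ (k + 1) (m + 1)
              (fun l => (((Fin.cons a mu : Fin (k + 2) → ℕ) l : ℕ) : ℤ_[p])) =
          ∑ ij ∈ Finset.HasAntidiagonal.antidiagonal m, ((ij.2 + 1 : ℕ) : ℚ_[p])⁻¹ *
            (((newtonSign (κ 0) a : ℤ) : ℚ_[p]) *
              ((Ring.choose (a : ℤ_[p]) ij.1 : ℤ_[p]) : ℚ_[p])) *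
            (((∏ l, newtonSign (Fin.tail κ l) (mu l) : ℤ) : ℚ_[p]) *
              binomDQ k ij.2 (fun l => (mu l : ℤ_[p]))) := fun a mu => by
        rw [Fin.prod_univ_succ, binomDQ, Finset.mul_sum]
        refine Finset.sum_congr rfl fun ij _ => ?_
        simp only [Fin.cons_zero, Fin.cons_succ, Fin.tail, Int.cast_mul]
        ring_nf
        rfl
      simp only [hterm]
      have hswap : ∀ a : ℕ, ∑ mu ∈ Finset.Iic (Fin.tail κ), ∑ ij ∈ Finset.HasAntidiagonal.antidiagonal m,
          ((ij.2 + 1 : ℕ) : ℚ_[p])⁻¹ * (((newtonSign (κ 0) a : ℤ) : ℚ_[p]) *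
              ((Ring.choose (a : ℤ_[p]) ij.1 : ℤ_[p]) : ℚ_[p])) *
            (((∏ l, newtonSign (Fin.tail κ l) (mu l) : ℤ) : ℚ_[p]) *
              binomDQ k ij.2 (fun l => (mu l : ℤ_[p]))) =
          ∑ ij ∈ Finset.HasAntidiagonal.antidiagonal m, (((newtonSign (κ 0) a : ℤ) : ℚ_[p]) *
              ((Ring.choose (a : ℤ_[p]) ij.1 : ℤ_[p]) : ℚ_[p])) *
            (((ij.2 + 1 : ℕ) : ℚ_[p])⁻¹ *
              if ∑ l, Fin.tail κ l + k = ij.2 then stepCoeff p k (Fin.tail κ) else 0) :=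
          fun a => by
        rw [Finset.sum_comm]
        refine Finset.sum_congr rfl fun ij _ => ?_
        rw [← Finset.mul_sum, ih]
        ring
      simp only [hswap]
      rw [Finset.sum_comm]
      simp only [← Finset.sum_mul, hsign]
      have hsum : ∑ l, κ l = κ 0 + ∑ l, Fin.tail κ l := Fin.sum_univ_succ κ
      by_cases h : ∑ l, κ l + (k + 1) = m + 1
      · rw [if_pos h, Finset.sum_eq_single (κ 0, ∑ l, Fin.tail κ l + k)]
        · simp [stepCoeff]
        · rintro ⟨i, j⟩ _ hij
          dsimp only
          split_ifs with h1 h2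
          · exact absurd (by rw [h1, h2]) hij
          all_goals simp
        · intro hmem
          exact absurd (Finset.HasAntidiagonal.mem_antidiagonal.2 (by dsimp only; omega)) hmem
      · rw [if_neg h]
        refine Finset.sum_eq_zero ?_
        rintro ⟨i, j⟩ hij
        have hij := Finset.HasAntidiagonal.mem_antidiagonal.1 hij
        dsimp only at hij ⊢
        split_ifs with h1 h2
        · exact absurd (by omega) h
        all_goals simp

/-- The polynomial bound on `stepCoeff` is sharp up to a constant: the tail sums are free, so every
factor can be made the inverse of a power of p comparable to `m`. -/
theorem exists_stepCoeff_le (k : ℕ) : ∃ C : ℝ, 0 < C ∧ ∀ m : ℕ, p ^ k ≤ m →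
    ∃ κ : Fin (k + 1) → ℕ, ∑ l, κ l + k = m ∧ C * (m : ℝ) ^ k ≤ ‖stepCoeff p k κ‖ := by
  have hp1 : 1 < p := (Fact.out : p.Prime).one_lt
  induction k with
  | zero => exact ⟨1, one_pos, fun m _ => ⟨fun _ => m, by simp [stepCoeff]⟩⟩
  | succ k ih =>
    obtain ⟨C, hC, h⟩ := ih
    have hpR : (0 : ℝ) < p := by exact_mod_cast (zero_lt_one.trans hp1)
    refine ⟨C * (2 ^ k)⁻¹ * ((p : ℝ) ^ (k + 1))⁻¹, by positivity, fun m hm => ?_⟩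
    have hm0 : m ≠ 0 := (lt_of_lt_of_le (pow_pos (zero_lt_one.trans hp1) _) hm).ne'
    set s := Nat.log p m with hs
    have hsm : p ^ s ≤ m := Nat.pow_log_le_self p hm0
    have hms : m < p ^ (s + 1) := Nat.lt_pow_succ_log_self hp1 m
    have hks : k + 1 ≤ s := Nat.le_log_of_pow_le hp1 hm
    have hpk : 2 * p ^ k ≤ p ^ s := by
      calc 2 * p ^ k ≤ p * p ^ k := Nat.mul_le_mul_right _ hp1
        _ = p ^ (k + 1) := (pow_succ' p k).symm
        _ ≤ p ^ s := Nat.pow_le_pow_right (by omega) hks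
    have hpk1 : 1 ≤ p ^ k := Nat.one_le_pow _ _ (by omega)
    -- A tail for `p ^ s - 1` makes the new factor exactly `(p ^ s)⁻¹`, of norm p^s > m/p. The
    -- induction hypothesis applies because s ≥ k+1 gives p^s - 1 ≥ p^k, and p^s - 1 ≥ p^s/2 is
    -- where the factor 2^k in the constant comes from.
    obtain ⟨κ, hκ, hκC⟩ := h (p ^ s - 1) (by omega)
    refine ⟨Fin.cons (m - p ^ s) κ, ?_, ?_⟩
    · rw [Fin.sum_univ_succ]
      simp only [Fin.cons_zero, Fin.cons_succ]
      omega
    · have hc : stepCoeff p (k + 1) (Fin.cons (m - p ^ s) κ) =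
          ((p ^ s : ℕ) : ℚ_[p])⁻¹ * stepCoeff p k κ := by
        rw [stepCoeff, Fin.tail_cons, hκ, Nat.sub_add_cancel (by omega)]
      have hn : ‖((p ^ s : ℕ) : ℚ_[p])⁻¹‖ = (p : ℝ) ^ s := by
        rw [norm_inv, Nat.cast_pow, norm_pow, Padic.norm_p, inv_pow, inv_inv]
      rw [hc, norm_mul, hn]
      have h1 : (m : ℝ) ≤ p * p ^ s := by
        have : (m : ℝ) ≤ p ^ (s + 1) := by exact_mod_cast hms.le
        rwa [pow_succ'] at this
      have h2 : (p : ℝ) ^ s ≤ 2 * ((p ^ s - 1 : ℕ) : ℝ) := by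
        have : p ^ s ≤ 2 * (p ^ s - 1) := by omega
        exact_mod_cast this
      have h3 : (m : ℝ) ^ (k + 1) ≤ (p : ℝ) ^ (k + 1) * (p ^ s * (2 ^ k * ((p ^ s - 1 : ℕ) : ℝ) ^ k)) := by
        calc (m : ℝ) ^ (k + 1) ≤ (p * p ^ s) ^ (k + 1) := pow_le_pow_left₀ (by positivity) h1 _
          _ = (p : ℝ) ^ (k + 1) * (p ^ s * (p ^ s) ^ k) := by ring
          _ ≤ (p : ℝ) ^ (k + 1) * (p ^ s * (2 * ((p ^ s - 1 : ℕ) : ℝ)) ^ k) := by gcongr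
          _ = _ := by rw [mul_pow]
      calc C * (2 ^ k)⁻¹ * ((p : ℝ) ^ (k + 1))⁻¹ * (m : ℝ) ^ (k + 1)
          ≤ C * (2 ^ k)⁻¹ * ((p : ℝ) ^ (k + 1))⁻¹ *
            ((p : ℝ) ^ (k + 1) * (p ^ s * (2 ^ k * ((p ^ s - 1 : ℕ) : ℝ) ^ k))) := by gcongr
        _ = p ^ s * (C * ((p ^ s - 1 : ℕ) : ℝ) ^ k) := by field_simp
        _ ≤ _ := by gcongr

theorem exists_le_stepCoeff (p : ℕ) [Fact p.Prime] (b : ℕ) : ∃ C : ℝ, 0 < C ∧ ∀ m : ℕ, ∃ k ≤ b,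
    ∃ κ : Fin (k + 1) → ℕ, ∑ l, κ l + k = m ∧ C * (m : ℝ) ^ b ≤ ‖stepCoeff p k κ‖ := by
  obtain ⟨C, hC, h⟩ := exists_stepCoeff_le (p := p) b
  have hp0 : (0 : ℝ) < p := by exact_mod_cast (Fact.out : p.Prime).pos
  refine ⟨min C (((p : ℝ) ^ b) ^ b)⁻¹, by positivity, fun m => ?_⟩
  by_cases hm : p ^ b ≤ m
  · obtain ⟨κ, h1, h2⟩ := h m hm
    exact ⟨b, le_rfl, κ, h1, le_trans (by gcongr; exact min_le_left _ _) h2⟩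
  -- For small `m` there may be no κ of order `b`. Order 0 has coefficient 1, which suffices since
  -- m^b is bounded; hence all orders up to `b` are admitted.
  · refine ⟨0, Nat.zero_le b, fun _ => m, by simp, ?_⟩
    have h1 : (m : ℝ) ≤ (p : ℝ) ^ b := by exact_mod_cast (not_le.1 hm).le
    calc min C (((p : ℝ) ^ b) ^ b)⁻¹ * (m : ℝ) ^ b
        ≤ (((p : ℝ) ^ b) ^ b)⁻¹ * ((p : ℝ) ^ b) ^ b := by gcongr; exact min_le_right _ _
      _ = 1 := inv_mul_cancel₀ (by positivity)
      _ = _ := by simp [stepCoeff]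

end BinomDQ

/-! ### Ultrametric seminorms and series in sequentially complete spaces -/

section UltraSeminorm

theorem seminorm_sum_le {K E α : Type*} [NormedField K] [AddCommGroup E] [Module K E]
    {q : Seminorm K E} (hq : IsNonarchimedean q) {s : Finset α} {f : α → E} {ε : ℝ} (hε : 0 ≤ ε)
    (h : ∀ i ∈ s, q (f i) ≤ ε) : q (∑ i ∈ s, f i) ≤ ε := by
  classical
  induction s using Finset.induction_on with
  | empty => simpa using hε
  | insert a s ha ih =>
    rw [Finset.sum_insert ha]
    exact (hq _ _).trans (max_le (h a (Finset.mem_insert_self a s))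
      (ih fun i hi => h i (Finset.mem_insert_of_mem hi)))

theorem seminorm_hasSum_le {K E : Type*} [NormedField K] [AddCommGroup E] [Module K E]
    [TopologicalSpace E] {q : Seminorm K E} (hq : Continuous q) (hq' : IsNonarchimedean q)
    {X : Type*} {u : X → E} {a : E} (ha : HasSum u a) {ε : ℝ} (hε : 0 ≤ ε)
    (hu : ∀ x, q (u x) ≤ ε) : q a ≤ ε :=
  le_of_tendsto ((hq.tendsto a).comp ha)
    (Eventually.of_forall fun _ => seminorm_sum_le hq' hε fun x _ => hu x)

variable {K : Type*} [NontriviallyNormedField K] {E : Type*} [AddCommGroup E] [Module K E]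

/-- The gauge of a set `S` with respect to the norm of the field `K`. -/
def fieldGauge (K : Type*) [NontriviallyNormedField K] [Module K E] (S : Set E) (x : E) : ℝ :=
  sInf {r | ∃ c : K, (∃ s ∈ S, x = c • s) ∧ r = ‖c‖}

theorem fieldGauge_nonneg (S : Set E) (x : E) : 0 ≤ fieldGauge K S x :=
  Real.sInf_nonneg (by rintro _ ⟨c, _, rfl⟩; exact norm_nonneg c)

theorem fieldGauge_le {S : Set E} {c : K} {s : E} (hs : s ∈ S) :
    fieldGauge K S (c • s) ≤ ‖c‖ :=
  csInf_le ⟨0, by rintro _ ⟨c, _, rfl⟩; exact norm_nonneg c⟩ ⟨c, ⟨s, hs, rfl⟩, rfl⟩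

theorem exists_of_fieldGauge_lt {S : Set E} (hS : Absorbent K S) {x : E} {r : ℝ}
    (h : fieldGauge K S x < r) : ∃ c : K, ‖c‖ < r ∧ ∃ s ∈ S, x = c • s := by
  have hne : {r | ∃ c : K, (∃ s ∈ S, x = c • s) ∧ r = ‖c‖}.Nonempty := by
    obtain ⟨c, hc⟩ := (hS x).exists
    obtain ⟨s, hs, hsx⟩ := hc rfl
    exact ⟨_, c, ⟨s, hs, hsx.symm⟩, rfl⟩
  obtain ⟨_, ⟨c, hc, rfl⟩, hlt⟩ := exists_lt_of_csInf_lt hne h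
  exact ⟨c, hlt, hc⟩

theorem fieldGauge_add_le {S : AddSubgroup E} (hS : Absorbent K (S : Set E))
    (hS' : ∀ c : K, ‖c‖ ≤ 1 → ∀ x ∈ S, c • x ∈ S) (x y : E) :
    fieldGauge K (S : Set E) (x + y) ≤
      max (fieldGauge K (S : Set E) x) (fieldGauge K (S : Set E) y) := by
  have key : ∀ c d : K, ‖c‖ ≤ ‖d‖ → ∀ s ∈ S, ∀ t ∈ S,
      fieldGauge K (S : Set E) (c • s + d • t) ≤ ‖d‖ := by
    intro c d hcd s hs t ht
    rcases eq_or_ne d 0 with rfl | hd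
    · have hc : c = 0 := norm_le_zero_iff.1 (by simpa using hcd)
      simpa [hc] using fieldGauge_le (K := K) (c := 0) S.zero_mem
    · have : c • s + d • t = d • ((d⁻¹ * c) • s + t) := by
        rw [smul_add, smul_smul, mul_inv_cancel_left₀ hd]
      rw [this]
      refine fieldGauge_le (S.add_mem (hS' _ ?_ s hs) ht)
      rw [norm_mul, norm_inv, inv_mul_le_iff₀ (norm_pos_iff.2 hd), mul_one]
      exact hcd
  refine le_of_forall_gt fun r hr => ?_
  obtain ⟨c, hc, s, hs, rfl⟩ := exists_of_fieldGauge_lt hS ((le_max_left _ _).trans_lt hr)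
  obtain ⟨d, hd, t, ht, rfl⟩ := exists_of_fieldGauge_lt hS ((le_max_right _ _).trans_lt hr)
  rcases le_total ‖c‖ ‖d‖ with h | h
  · exact (key c d h s hs t ht).trans_lt hd
  · rw [add_comm]
    exact (key d c h t ht s hs).trans_lt hc

theorem fieldGauge_smul_le {S : Set E} (hS : Absorbent K S) (a : K) (x : E) :
    fieldGauge K S (a • x) ≤ ‖a‖ * fieldGauge K S x := by
  rcases eq_or_ne a 0 with rfl | ha
  · obtain ⟨c, -, s, hs, -⟩ := exists_of_fieldGauge_lt hS (lt_add_one (fieldGauge K S x))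
    simpa using fieldGauge_le (K := K) (c := 0) hs
  · have ha' : 0 < ‖a‖ := norm_pos_iff.2 ha
    rw [← div_le_iff₀' ha']
    refine le_of_forall_gt fun r hr => ?_
    obtain ⟨c, hc, s, hs, rfl⟩ := exists_of_fieldGauge_lt hS hr
    rw [div_lt_iff₀' ha', smul_smul]
    exact (fieldGauge_le hs).trans_lt (by rw [norm_mul]; gcongr)

/-- The gauge of an open 𝕆-submodule `S` inside `U` works: a gauge below 1 means `x = c • s` with
‖c‖ < 1, whence `x ∈ S`. -/
theorem IsUltraLocallyConvex.exists_seminorm [TopologicalSpace E] [IsTopologicalAddGroup E]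
    [ContinuousSMul K E] (h : IsUltraLocallyConvex K E) {U : Set E} (hU : U ∈ 𝓝 (0 : E)) :
    ∃ q : Seminorm K E, Continuous q ∧ IsNonarchimedean q ∧ ∀ x, q x < 1 → x ∈ U := by
  obtain ⟨S, ⟨hSo, hS⟩, hSU⟩ := h.mem_iff.1 hU
  have hS0 : (S : Set E) ∈ 𝓝 (0 : E) := hSo.mem_nhds S.zero_mem
  have habs : Absorbent K (S : Set E) := absorbent_nhds_zero hS0
  let q : Seminorm K E := Seminorm.ofSMulLE (fieldGauge K (S : Set E))
    (le_antisymm (by simpa using fieldGauge_le (K := K) (c := 0) S.zero_mem)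
      (fieldGauge_nonneg _ _))
    (fun x y => (fieldGauge_add_le habs hS x y).trans
      (max_le_add_of_nonneg (fieldGauge_nonneg _ _) (fieldGauge_nonneg _ _)))
    (fieldGauge_smul_le habs)
  refine ⟨q, Seminorm.continuous' (r := 1) (mem_of_superset hS0 fun x hx => ?_),
    fieldGauge_add_le habs hS, fun x hx => ?_⟩
  · rw [Seminorm.mem_closedBall_zero]
    have h1 : fieldGauge K (S : Set E) x ≤ 1 := by
      simpa using fieldGauge_le (K := K) (c := 1) hx
    exact h1
  · obtain ⟨c, hc, s, hs, rfl⟩ := exists_of_fieldGauge_lt habs hx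
    exact hSU (hS c hc.le s hs)

end UltraSeminorm

/-! ### Uniform convergence and series under sequential completeness -/

section Series

variable {K : Type*} [NontriviallyNormedField K] {E : Type*} [AddCommGroup E] [Module K E]
  [UniformSpace E] [IsUniformAddGroup E] [ContinuousSMul K E]

theorem IsUltraLocallyConvex.tendstoUniformlyOn_iff (h : IsUltraLocallyConvex K E) {X T : Type*}
    {F : X → T → E} {f : T → E} {L : Filter X} {s : Set T} :
    TendstoUniformlyOn F f L s ↔ ∀ q : Seminorm K E, Continuous q → IsNonarchimedean q →
      ∀ ε : ℝ, 0 < ε → ∀ᶠ n in L, ∀ x ∈ s, q (F n x - f x) < ε := by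
  constructor
  · intro H q hq _ ε hε
    have hV : {z : E × E | q (z.2 - z.1) < ε} ∈ uniformity E := by
      rw [uniformity_eq_comap_nhds_zero]
      refine ⟨{x | q x < ε}, ?_, fun _ hz => hz⟩
      exact (isOpen_lt hq continuous_const).mem_nhds (by simpa using hε)
    exact H _ hV
  · intro H V hV
    rw [uniformity_eq_comap_nhds_zero] at hV
    obtain ⟨U, hU, hUV⟩ := hV
    obtain ⟨q, hq, hq', hqU⟩ := h.exists_seminorm hU
    exact (H q hq hq' 1 one_pos).mono fun n hn x hx => hUV (hqU _ (hn x hx))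

theorem IsUltraLocallyConvex.summable (h : IsUltraLocallyConvex K E)
    (hcomplete : ∀ u : ℕ → E, CauchySeq u → ∃ a, Tendsto u atTop (𝓝 a))
    {X : Type*} [Countable X] {u : X → E}
    (hu : ∀ q : Seminorm K E, Continuous q → IsNonarchimedean q → ∀ ε : ℝ, 0 < ε →
      ∃ Φ : Finset X, ∀ x ∉ Φ, q (u x) < ε) : Summable u := by
  classical
  have hcauchy : CauchySeq fun s : Finset X => ∑ x ∈ s, u x := by
    rw [cauchySeq_finset_iff_sum_vanishing]
    intro e he
    obtain ⟨q, hq, hq', hqe⟩ := h.exists_seminorm he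
    obtain ⟨Φ, hΦ⟩ := hu q hq hq' (1 / 2) one_half_pos
    refine ⟨Φ, fun t ht => hqe _ (lt_of_le_of_lt (seminorm_sum_le hq' one_half_pos.le
      fun x hx => (hΦ x (Finset.disjoint_left.1 ht hx)).le) one_half_lt_one)⟩
  obtain ⟨F, hF⟩ := exists_seq_tendsto (atTop : Filter (Finset X))
  obtain ⟨a, ha⟩ := hcomplete _ (hcauchy.comp_tendsto hF)
  exact ⟨a, tendsto_nhds_of_cauchySeq_of_subseq hcauchy hF ha⟩

theorem IsUltraLocallyConvex.continuous_tsum (h : IsUltraLocallyConvex K E) [T2Space E]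
    {X T : Type*} [TopologicalSpace T] {u : X → T → E} (hc : ∀ x, Continuous (u x))
    (hs : ∀ t, Summable fun x => u x t)
    (hu : ∀ q : Seminorm K E, Continuous q → IsNonarchimedean q → ∀ ε : ℝ, 0 < ε →
      ∃ Φ : Finset X, ∀ x ∉ Φ, ∀ t, q (u x t) < ε) :
    Continuous fun t => ∑' x, u x t := by
  classical
  have hunif : TendstoUniformlyOn (fun (s : Finset X) t => ∑ x ∈ s, u x t)
      (fun t => ∑' x, u x t) atTop Set.univ := by
    rw [h.tendstoUniformlyOn_iff]
    intro q hq hq' ε hε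
    obtain ⟨Φ, hΦ⟩ := hu q hq hq' (ε / 2) (half_pos hε)
    filter_upwards [eventually_ge_atTop Φ] with s hs' t _
    rw [map_sub_rev]
    have hsum := (hs t).hasSum
    have h2 := hsum.sub (hasSum_sum_of_ne_finset_zero (f := fun x => if x ∈ s then u x t else 0)
      (s := s) fun x hx => if_neg hx)
    have h3 : ∑ x ∈ s, (if x ∈ s then u x t else 0) = ∑ x ∈ s, u x t :=
      Finset.sum_congr rfl fun x hx => if_pos hx
    rw [h3] at h2
    refine (seminorm_hasSum_le hq hq' h2 (half_pos hε).le fun x => ?_).trans_lt (half_lt_self hε)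
    by_cases hx : x ∈ s
    · simpa [hx] using (half_pos hε).le
    · simpa [hx] using (hΦ x (fun h' => hx (hs' h')) t).le
  rw [tendstoUniformlyOn_univ] at hunif
  exact hunif.continuous (Frequently.of_forall fun s => continuous_finsetSum s fun x _ => hc x)

end Series

/-! ### Newton coefficients in several variables -/

section NewtonCoeff

variable {ι : Type*} [Fintype ι] [DecidableEq ι] {J : ι → Type*} [∀ i, Fintype (J i)]
  [∀ i, DecidableEq (J i)] {E : Type*} [AddCommGroup E]

/-- The Newton coefficients of a function of several natural numbers. -/
def newtonCoeff (g : ((i : ι) → J i → ℕ) → E) (κ : (i : ι) → J i → ℕ) : E :=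
  ∑ lam ∈ Finset.Iic κ, (∏ i, ∏ l, newtonSign (κ i l) (lam i l)) • g lam

theorem newtonCoeff_sub (g h : ((i : ι) → J i → ℕ) → E) (κ : (i : ι) → J i → ℕ) :
    newtonCoeff (fun lam => g lam - h lam) κ = newtonCoeff g κ - newtonCoeff h κ := by
  simp [newtonCoeff, smul_sub]

theorem sum_Iic_prod {R : Type*} [CommSemiring R] (κ : ι → ℕ) (F : ι → ℕ → R) :
    ∑ lam ∈ Finset.Iic κ, ∏ i, F i (lam i) = ∏ i, ∑ b ∈ Finset.Iic (κ i), F i b := by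
  rw [Finset.prod_univ_sum]
  exact Finset.sum_congr (by ext; simp [Pi.le_def]) fun _ _ => rfl

theorem sum_Iic_prod_prod {R : Type*} [CommSemiring R] (κ : (i : ι) → J i → ℕ)
    (F : (i : ι) → (J i → ℕ) → R) :
    ∑ lam ∈ Finset.Iic κ, ∏ i, F i (lam i) = ∏ i, ∑ b ∈ Finset.Iic (κ i), F i b := by
  rw [Finset.prod_univ_sum]
  exact Finset.sum_congr (by ext; simp [Pi.le_def]) fun _ _ => rfl

variable {p : ℕ} [Fact p.Prime] [Module ℚ_[p] E]

theorem seminorm_zsmul (q : Seminorm ℚ_[p] E) (z : ℤ) (x : E) :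
    q (z • x) = ‖(z : ℚ_[p])‖ * q x := by
  rw [← Int.cast_smul_eq_zsmul ℚ_[p], map_smul_eq_mul]

theorem seminorm_zsmul_le (q : Seminorm ℚ_[p] E) (z : ℤ) (x : E) : q (z • x) ≤ q x := by
  rw [seminorm_zsmul]
  exact mul_le_of_le_one_left (apply_nonneg q x) (Padic.norm_int_le_one z)

theorem seminorm_newtonCoeff_le {q : Seminorm ℚ_[p] E} (hq : IsNonarchimedean q)
    (g : ((i : ι) → J i → ℕ) → E) (κ : (i : ι) → J i → ℕ) {ε : ℝ} (hε : 0 ≤ ε)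
    (h : ∀ lam, q (g lam) ≤ ε) : q (newtonCoeff g κ) ≤ ε :=
  seminorm_sum_le hq hε fun lam _ => (seminorm_zsmul_le q _ _).trans (h lam)

/-- The Newton coefficients of the indicator function of a residue class. -/
def residueCoeff (m r a : ℕ) : ℤ :=
  ∑ b ∈ Finset.Iic a, newtonSign a b * if b % m = r then 1 else 0

theorem newtonCoeff_residues (m : ℕ) (c : E) (r κ : (i : ι) → J i → ℕ) :
    newtonCoeff (fun lam => (∏ i, ∏ l, if lam i l % m = r i l then (1 : ℤ) else 0) • c) κ =
      (∏ i, ∏ l, residueCoeff m (r i l) (κ i l)) • c := by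
  simp only [newtonCoeff, smul_smul, ← Finset.prod_mul_distrib]
  rw [← Finset.sum_smul, sum_Iic_prod_prod κ (fun i b => ∏ l, (newtonSign (κ i l) (b l) *
    if b l % m = r i l then (1 : ℤ) else 0))]
  congr 1
  refine Finset.prod_congr rfl fun i _ => ?_
  exact sum_Iic_prod (κ i) (fun l b => newtonSign (κ i l) b * if b % m = r i l then (1 : ℤ) else 0)

/-- The indicator of a residue class is locally constant on ℤ_p, so the one-variable Mahler theorem
applies. -/
theorem tendsto_residueCoeff (p : ℕ) [Fact p.Prime] (t r : ℕ) (hr : r < p ^ t) :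
    Tendsto (fun a => ‖(residueCoeff (p ^ t) r a : ℚ_[p])‖) atTop (𝓝 0) := by
  classical
  have hpt : 0 < p ^ t := pow_pos (Fact.out : p.Prime).pos t
  have hmem : ∀ x : ℤ_[p], ∀ y : ℤ_[p], ‖x - y‖ ≤ (p : ℝ) ^ (-t : ℤ) ↔
      PadicInt.toZModPow t x = PadicInt.toZModPow t y := fun x y => by
    rw [PadicInt.norm_le_pow_iff_mem_span_pow, ← PadicInt.ker_toZModPow, RingHom.mem_ker,
      map_sub, sub_eq_zero]
  have hloc : IsLocallyConstant (PadicInt.toZModPow (p := p) t) := by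
    rw [IsLocallyConstant.iff_eventually_eq]
    intro x
    have hpos : (0 : ℝ) < (p : ℝ) ^ (-t : ℤ) :=
      zpow_pos (by exact_mod_cast (Fact.out : p.Prime).pos) _
    filter_upwards [Metric.ball_mem_nhds x hpos] with y hy
    rw [Metric.mem_ball, dist_eq_norm] at hy
    exact (hmem y x).1 hy.le
  let f : C(ℤ_[p], ℤ_[p]) :=
    ⟨fun x => if PadicInt.toZModPow t x = (r : ZMod (p ^ t)) then 1 else 0,
      (hloc.comp fun z => if z = (r : ZMod (p ^ t)) then (1 : ℤ_[p]) else 0).continuous⟩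
  have hf : ∀ b : ℕ, f b = if b % p ^ t = r then 1 else 0 := fun b => by
    have : (PadicInt.toZModPow t (b : ℤ_[p]) = (r : ZMod (p ^ t))) ↔ b % p ^ t = r := by
      rw [map_natCast, ZMod.natCast_eq_natCast_iff', Nat.mod_eq_of_lt hr]
    simp only [f, ContinuousMap.coe_mk, this]
  have h := (PadicInt.fwdDiff_tendsto_zero f).norm
  rw [norm_zero] at h
  refine h.congr fun a => ?_
  have : (fwdDiff 1)^[a] f 0 = ((residueCoeff (p ^ t) r a : ℤ) : ℤ_[p]) := by
    rw [fwdDiff_iter_eq_sum_shift, residueCoeff, Int.cast_sum]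
    refine Finset.sum_congr (by ext; simp) fun b _ => ?_
    rw [zero_add, nsmul_one, hf, newtonSign]
    split_ifs <;> simp
  rw [this, PadicInt.norm_def, PadicInt.coe_intCast]

theorem prod_le_factor {α : Type*} {s : Finset α} [DecidableEq α] {f : α → ℝ}
    (h0 : ∀ a ∈ s, 0 ≤ f a) (h1 : ∀ a ∈ s, f a ≤ 1) {a : α} (ha : a ∈ s) :
    ∏ x ∈ s, f x ≤ f a := by
  rw [← Finset.mul_prod_erase s f ha]
  exact mul_le_of_le_one_right (h0 a ha) (Finset.prod_le_one
    (fun x hx => h0 x (Finset.mem_of_mem_erase hx)) fun x hx => h1 x (Finset.mem_of_mem_erase hx))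

theorem prod_prod_le_factor {f : (i : ι) → J i → ℝ} (h0 : ∀ i l, 0 ≤ f i l)
    (h1 : ∀ i l, f i l ≤ 1) (i : ι) (l : J i) : ∏ i, ∏ l, f i l ≤ f i l :=
  (prod_le_factor (fun i _ => Finset.prod_nonneg fun l _ => h0 i l)
    (fun i _ => Finset.prod_le_one (fun l _ => h0 i l) fun l _ => h1 i l)
    (Finset.mem_univ i)).trans
  (prod_le_factor (fun l _ => h0 i l) (fun l _ => h1 i l) (Finset.mem_univ l))

variable [UniformSpace E] [IsUniformAddGroup E]

omit [DecidableEq ι] [∀ i, DecidableEq (J i)] in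
theorem exists_pow_forall_seminorm_sub_lt {q : Seminorm ℚ_[p] E} (hq : Continuous q)
    {G : ((i : ι) → J i → ℤ_[p]) → E} (hG : Continuous G) {ε : ℝ} (hε : 0 < ε) :
    ∃ t : ℕ, ∀ y z, (∀ i l, ‖y i l - z i l‖ ≤ (p : ℝ) ^ (-t : ℤ)) → q (G y - G z) < ε := by
  have hV : {z : E × E | q (z.2 - z.1) < ε} ∈ uniformity E := by
    rw [uniformity_eq_comap_nhds_zero]
    refine ⟨{x | q x < ε}, ?_, fun _ hz => hz⟩
    exact (isOpen_lt hq continuous_const).mem_nhds (by simpa using hε)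
  have hu := CompactSpace.uniformContinuous_of_continuous hG hV
  obtain ⟨δ, hδ, h⟩ := Metric.mem_uniformity_dist.1 hu
  obtain ⟨t, ht⟩ := PadicInt.exists_pow_neg_lt p hδ
  refine ⟨t, fun y z hyz => ?_⟩
  have hd : dist z y < δ := by
    rw [dist_pi_lt_iff hδ]
    intro i
    rw [dist_pi_lt_iff hδ]
    intro l
    rw [dist_comm, dist_eq_norm]
    exact (hyz i l).trans_lt ht
  exact h hd

/-- Multivariate Mahler decay. By uniform continuity, `G` is within ε/2 of a function of residues
mod p^t, and the integral Newton matrix does not enlarge this error. The approximant is a finite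
combination of products of residue indicators, whose Newton coefficients factor and are small as
soon as one index is large. -/
theorem finite_newtonCoeff_ge {q : Seminorm ℚ_[p] E} (hq : Continuous q)
    (hq' : IsNonarchimedean q) {G : ((i : ι) → J i → ℤ_[p]) → E} (hG : Continuous G)
    {ε : ℝ} (hε : 0 < ε) :
    {κ : (i : ι) → J i → ℕ |
      ε ≤ q (newtonCoeff (fun lam => G fun i l => (lam i l : ℤ_[p])) κ)}.Finite := by
  classical
  have hε2 : 0 < ε / 2 := half_pos hε
  obtain ⟨t, ht⟩ := exists_pow_forall_seminorm_sub_lt hq hG hε2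
  have hpt : 0 < p ^ t := pow_pos (Fact.out : p.Prime).pos t
  set R : Finset ((i : ι) → J i → ℕ) :=
    Fintype.piFinset fun i => Fintype.piFinset fun l => Finset.range (p ^ t) with hR
  set g : ((i : ι) → J i → ℕ) → E := fun lam => G fun i l => (lam i l : ℤ_[p]) with hg
  set gt : ((i : ι) → J i → ℕ) → E := fun lam => ∑ r ∈ R,
    (∏ i, ∏ l, if lam i l % p ^ t = r i l then (1 : ℤ) else 0) • g r with hgt
  have hgt' : ∀ lam, gt lam = g fun i l => lam i l % p ^ t := fun lam => by
    rw [hgt]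
    dsimp only
    rw [Finset.sum_eq_single fun i l => lam i l % p ^ t]
    · simp
    · intro r _ hr
      obtain ⟨i, hi⟩ := Function.ne_iff.1 hr
      obtain ⟨l, hl⟩ := Function.ne_iff.1 hi
      rw [Finset.prod_eq_zero (Finset.mem_univ i)
        (Finset.prod_eq_zero (Finset.mem_univ l) (if_neg (Ne.symm hl))), zero_smul]
    · intro h
      exact absurd (by simp [hR, Nat.mod_lt _ hpt]) h
  have hclose : ∀ lam, q (g lam - gt lam) ≤ ε / 2 := fun lam => by
    rw [hgt']
    refine (ht _ _ fun i l => ?_).le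
    have hdvd : (((p ^ t : ℕ) : ℤ)) ∣ ((lam i l : ℤ) - ((lam i l % p ^ t : ℕ) : ℤ)) :=
      (Nat.modEq_iff_dvd.1 (Nat.mod_modEq (lam i l) (p ^ t)))
    have := (PadicInt.norm_int_le_pow_iff_dvd (p := p)
      (k := (lam i l : ℤ) - ((lam i l % p ^ t : ℕ) : ℤ)) (n := t)).2 (by exact_mod_cast hdvd)
    rwa [Int.cast_sub, Int.cast_natCast, Int.cast_natCast] at this
  obtain ⟨B, hB, hBq⟩ : ∃ B : ℝ, 0 < B ∧ ∀ r ∈ R, q (g r) ≤ B :=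
    ⟨1 + ∑ r ∈ R, q (g r), by
      have := Finset.sum_nonneg fun r (_ : r ∈ R) => apply_nonneg q (g r)
      linarith, fun r hr => by
      have := Finset.single_le_sum (fun r _ => apply_nonneg q (g r)) hr
      linarith⟩
  have hN : ∀ᶠ a in atTop, ∀ r ∈ Finset.range (p ^ t),
      ‖(residueCoeff (p ^ t) r a : ℚ_[p])‖ < ε / 2 / B := by
    rw [Filter.eventually_all_finset]
    intro r hr
    exact (tendsto_residueCoeff p t r (Finset.mem_range.1 hr)).eventually_lt_const
      (div_pos hε2 hB)
  obtain ⟨N, hN⟩ := eventually_atTop.1 hN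
  refine (Finset.Iic fun (i : ι) (_ : J i) => N).finite_toSet.subset fun κ hκ => ?_
  rw [Finset.mem_coe, Finset.mem_Iic]
  by_contra hcon
  simp only [Pi.le_def, not_forall, not_le] at hcon
  obtain ⟨i, l, hil⟩ := hcon
  refine absurd (Set.mem_ofPred.1 hκ) (not_le.2 ?_)
  have hsplit : newtonCoeff g κ = newtonCoeff (fun lam => g lam - gt lam) κ +
      ∑ r ∈ R, (∏ i, ∏ l, residueCoeff (p ^ t) (r i l) (κ i l)) • g r := by
    rw [newtonCoeff_sub]
    have : newtonCoeff gt κ =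
        ∑ r ∈ R, (∏ i, ∏ l, residueCoeff (p ^ t) (r i l) (κ i l)) • g r := by
      simp only [← newtonCoeff_residues]
      simp only [newtonCoeff, hgt, Finset.smul_sum]
      rw [Finset.sum_comm]
    rw [this, sub_add_cancel]
  rw [hsplit]
  refine lt_of_le_of_lt (hq' _ _) (max_lt ?_ ?_)
  · exact (seminorm_newtonCoeff_le hq' _ κ hε2.le hclose).trans_lt (half_lt_self hε)
  · refine (seminorm_sum_le hq' hε2.le fun r hr => ?_).trans_lt (half_lt_self hε)
    rw [seminorm_zsmul]
    have h1 : ‖((∏ i, ∏ l, residueCoeff (p ^ t) (r i l) (κ i l) : ℤ) : ℚ_[p])‖ ≤ ε / 2 / B := by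
      push_cast
      simp only [norm_prod]
      refine (prod_prod_le_factor (fun i l => norm_nonneg _)
        (fun i l => Padic.norm_int_le_one _) i l).trans (hN _ hil.le _ ?_).le
      exact Fintype.mem_piFinset.1 (Fintype.mem_piFinset.1 hr i) l
    calc _ ≤ ε / 2 / B * B := mul_le_mul h1 (hBq r hr) (apply_nonneg _ _) (by positivity)
      _ = ε / 2 := div_mul_cancel₀ _ hB.ne'

end NewtonCoeff

/-! ### Mahler coefficients of differentiable functions -/

section Expansion

variable {p : ℕ} [Fact p.Prime] {ι : Type*} [Fintype ι] [DecidableEq ι]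
  {E : Type*} [AddCommGroup E]

theorem mahlerCoeff_eq_sum_newtonSign (f : zpPow p ι → E) (ν : ι → ℕ) :
    mahlerCoeff f ν =
      ∑ μ ∈ Finset.Iic ν, (∏ i, newtonSign (ν i) (μ i)) • f (natPoint p μ) := by
  refine Finset.sum_congr rfl fun μ hμ => ?_
  have hμ : μ ≤ ν := Finset.mem_Iic.1 hμ
  simp only [newtonSign, Finset.prod_mul_distrib, Finset.prod_pow_eq_pow_sum]
  rw [Finset.sum_tsub_distrib _ fun i _ => hμ i]

theorem sum_choose_smul_mahlerCoeff (f : zpPow p ι → E) (x : ι → ℕ) :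
    ∑ ν ∈ Finset.Iic x, (∏ i, ((x i).choose (ν i) : ℤ)) • mahlerCoeff f ν =
      f (natPoint p x) := by
  have h1 : ∀ ν ∈ Finset.Iic x, (∏ i, ((x i).choose (ν i) : ℤ)) • mahlerCoeff f ν =
      ∑ μ ∈ Finset.Iic x, (∏ i, ((x i).choose (ν i) : ℤ) * newtonSign (ν i) (μ i)) •
        f (natPoint p μ) := fun ν hν => by
    have hν : ν ≤ x := Finset.mem_Iic.1 hν
    rw [mahlerCoeff_eq_sum_newtonSign, Finset.smul_sum]
    simp only [smul_smul, ← Finset.prod_mul_distrib]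
    refine Finset.sum_subset (Finset.Iic_subset_Iic.2 hν) fun μ _ hμ => ?_
    simp only [Finset.mem_Iic, Pi.le_def, not_forall, not_le] at hμ
    obtain ⟨i, hi⟩ := hμ
    rw [Finset.prod_eq_zero (Finset.mem_univ i) (by rw [newtonSign_eq_zero hi, mul_zero]),
      zero_smul]
  rw [Finset.sum_congr rfl h1, Finset.sum_comm]
  simp only [← Finset.sum_smul]
  have h2 : ∀ μ : ι → ℕ, ∑ ν ∈ Finset.Iic x,
      ∏ i, ((x i).choose (ν i) : ℤ) * newtonSign (ν i) (μ i) = if x = μ then 1 else 0 :=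
      fun μ => by
    rw [sum_Iic_prod x fun i c => ((x i).choose c : ℤ) * newtonSign c (μ i)]
    simp only [sum_choose_mul_newtonSign le_rfl]
    split_ifs with h
    · simp [h]
    · obtain ⟨i, hi⟩ := Function.ne_iff.1 h
      exact Finset.prod_eq_zero (Finset.mem_univ i) (if_neg hi)
  simp only [h2, ite_smul, one_smul, zero_smul]
  rw [Finset.sum_ite_eq, if_pos (Finset.mem_Iic.2 le_rfl)]

variable [Module ℚ_[p] E] [TopologicalSpace E]

/-- At a natural point only finitely many terms are nonzero, so no decay or continuity is required.
-/
theorem hasSum_choose_smul_mahlerCoeff (f : zpPow p ι → E) (x : ι → ℕ) :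
    HasSum (fun ν : ι → ℕ => (∏ i, ((Ring.choose (x i : ℤ_[p]) (ν i) : ℤ_[p]) : ℚ_[p])) •
      mahlerCoeff f ν) (f (natPoint p x)) := by
  have hterm : ∀ ν : ι → ℕ, (∏ i, ((Ring.choose (x i : ℤ_[p]) (ν i) : ℤ_[p]) : ℚ_[p])) •
      mahlerCoeff f ν = (∏ i, ((x i).choose (ν i) : ℤ)) • mahlerCoeff f ν := fun ν => by
    rw [← Int.cast_smul_eq_zsmul ℚ_[p]]
    simp [Ring.choose_natCast]
  simp only [hterm]
  rw [← sum_choose_smul_mahlerCoeff f x]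
  refine hasSum_sum_of_ne_finset_zero fun ν hν => ?_
  simp only [Finset.mem_Iic, Pi.le_def, not_forall, not_le] at hν
  obtain ⟨i, hi⟩ := hν
  rw [Finset.prod_eq_zero (Finset.mem_univ i) (by rw [Nat.choose_eq_zero_of_lt hi]; rfl),
    zero_smul]

/-- A difference quotient is a finite linear combination of values, so it passes through the sum; on
a product of one-variable functions it factors into divided differences. -/
theorem hasSum_diffQuot {K : Type*} [Field K] [Module K E] [ContinuousAdd E]
    [ContinuousConstSMul K E] {U : Set (ι → K)} {f : U → E} {γ : ι → ℕ} (x : dqDomain U γ)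
    {X : Type*} (c : X → (i : ι) → Fin (γ i + 1) → K) (a : X → E)
    (h : ∀ j : (i : ι) → Fin (γ i + 1),
      HasSum (fun ν => (∏ i, c ν i (j i)) • a ν) (f ⟨fun i => x.1 i (j i), x.2 j⟩)) :
    HasSum (fun ν => (∏ i, divDiff (x.1 i) (c ν i)) • a ν) (diffQuot f γ x) := by
  have := hasSum_sum fun (j : (i : ι) → Fin (γ i + 1)) (_ : j ∈ Finset.univ) =>
    (h j).const_smul (∏ i, ∏ k ∈ Finset.univ.erase (j i), (x.1 i (j i) - x.1 i k)⁻¹)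
  have hterm : ∀ ν : X, ∑ j : (i : ι) → Fin (γ i + 1),
      (∏ i, ∏ k ∈ Finset.univ.erase (j i), (x.1 i (j i) - x.1 i k)⁻¹) •
        ((∏ i, c ν i (j i)) • a ν) = (∏ i, divDiff (x.1 i) (c ν i)) • a ν := fun ν => by
    simp only [smul_smul, ← Finset.sum_smul, divDiff]
    rw [Finset.prod_univ_sum, Fintype.piFinset_univ]
    simp only [Finset.prod_mul_distrib]
  simp only [hterm] at this
  exact this

end Expansion

/-! ### Newton coefficients of extended difference quotients -/

section StepMap

variable {p : ℕ} [Fact p.Prime] {ι : Type*}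

/-- `stepPoints` in each coordinate, as a map to the domain of the difference quotients. -/
def stepMap (p : ℕ) [Fact p.Prime] (γ : ι → ℕ) :
    C((i : ι) → Fin (γ i + 1) → ℤ_[p], dqDomain (zpPow p ι) γ) where
  toFun y := ⟨fun i l => ((stepPoints (γ i) (y i) l : ℤ_[p]) : ℚ_[p]),
    fun j i => (stepPoints (γ i) (y i) (j i)).2⟩
  continuous_toFun := by
    refine Continuous.subtype_mk (continuous_pi fun i => continuous_pi fun l => ?_) _
    exact continuous_subtype_val.comp ((continuous_apply l).comp
      ((continuous_stepPoints (γ i)).comp (continuous_apply i)))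

theorem natPoint_stepMap (γ : ι → ℕ) (lam : (i : ι) → Fin (γ i + 1) → ℕ)
    (j : (i : ι) → Fin (γ i + 1)) :
    (⟨fun i => (stepMap p γ fun i l => (lam i l : ℤ_[p])).1 i (j i),
      (stepMap p γ fun i l => (lam i l : ℤ_[p])).2 j⟩ : zpPow p ι) =
    natPoint p fun i => stepPoints (γ i) (lam i) (j i) := by
  refine Subtype.ext (funext fun i => ?_)
  change ((stepPoints (γ i) (fun l => (lam i l : ℤ_[p])) (j i) : ℤ_[p]) : ℚ_[p]) = _
  rw [stepPoints_natCast]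
  exact PadicInt.coe_natCast _

theorem injective_stepPoints_natCast (k : ℕ) (y : Fin (k + 1) → ℕ) :
    Function.Injective (stepPoints k fun l => (y l : ℤ_[p])) := by
  rw [stepPoints_natCast]
  exact Nat.cast_injective.comp (strictMono_stepPoints k y).injective

theorem stepMap_natCast_mem_dqOffDiag (γ : ι → ℕ) (lam : (i : ι) → Fin (γ i + 1) → ℕ) :
    stepMap p γ (fun i l => (lam i l : ℤ_[p])) ∈ dqOffDiag (zpPow p ι) γ := fun i =>
  Subtype.coe_injective.comp (injective_stepPoints_natCast (γ i) (lam i))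

variable [Fintype ι] [DecidableEq ι] {E : Type*} [AddCommGroup E] [Module ℚ_[p] E]
  [TopologicalSpace E] [IsTopologicalAddGroup E] [ContinuousSMul ℚ_[p] E] [T2Space E]

/-- At natural step coordinates `F` is the quotient of f, which expands into `binomDQ` times Mahler
coefficients. By `newton_binomDQ`, the transform at κ isolates the single index ν_i = |κ_i| + γ_i.
-/
theorem newtonCoeff_dqExtension {f : zpPow p ι → E} {γ : ι → ℕ}
    {F : C(dqDomain (zpPow p ι) γ, E)} (hF : IsDQExtension f γ F)
    (κ : (i : ι) → Fin (γ i + 1) → ℕ) :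
    newtonCoeff (fun lam => F (stepMap p γ fun i l => (lam i l : ℤ_[p]))) κ =
      (∏ i, stepCoeff p (γ i) (κ i)) • mahlerCoeff f fun i => ∑ l, κ i l + γ i := by
  have h1 : ∀ lam : (i : ι) → Fin (γ i + 1) → ℕ,
      HasSum (fun ν : ι → ℕ => (∏ i, binomDQ (γ i) (ν i) fun l => (lam i l : ℤ_[p])) •
        mahlerCoeff f ν) (F (stepMap p γ fun i l => (lam i l : ℤ_[p]))) := fun lam => by
    rw [hF _ (stepMap_natCast_mem_dqOffDiag γ lam)]
    have := hasSum_diffQuot (f := f) (stepMap p γ fun i l => (lam i l : ℤ_[p]))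
      (fun (ν : ι → ℕ) i j =>
        ((Ring.choose (stepPoints (γ i) (fun l => (lam i l : ℤ_[p])) j) (ν i) : ℤ_[p]) : ℚ_[p]))
      (mahlerCoeff f) fun j => by
        rw [natPoint_stepMap]
        simpa only [stepPoints_natCast] using hasSum_choose_smul_mahlerCoeff f
          fun i => stepPoints (γ i) (lam i) (j i)
    convert this using 5 with ν i
    exact (divDiff_choose _ _ _ (injective_stepPoints_natCast _ _)).symm
  have h2 := hasSum_sum fun lam (_ : lam ∈ Finset.Iic κ) =>
    (h1 lam).const_smul ((∏ i, ∏ l, newtonSign (κ i l) (lam i l) : ℤ) : ℚ_[p])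
  have h3 : ∀ ν : ι → ℕ, ∑ lam ∈ Finset.Iic κ,
      ((∏ i, ∏ l, newtonSign (κ i l) (lam i l) : ℤ) : ℚ_[p]) •
        ((∏ i, binomDQ (γ i) (ν i) fun l => (lam i l : ℤ_[p])) • mahlerCoeff f ν) =
      (∏ i, if ∑ l, κ i l + γ i = ν i then stepCoeff p (γ i) (κ i) else 0) •
        mahlerCoeff f ν := fun ν => by
    simp only [smul_smul, ← Finset.sum_smul, Int.cast_prod, ← Finset.prod_mul_distrib]
    rw [sum_Iic_prod_prod κ fun i b => (∏ l, ((newtonSign (κ i l) (b l) : ℤ) : ℚ_[p])) *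
      binomDQ (γ i) (ν i) fun l => (b l : ℤ_[p])]
    congr 1
    refine Finset.prod_congr rfl fun i _ => ?_
    rw [← newton_binomDQ]
    simp only [Int.cast_prod]
  simp only [h3] at h2
  have h4 := hasSum_single (f := fun ν : ι → ℕ =>
      (∏ i, if ∑ l, κ i l + γ i = ν i then stepCoeff p (γ i) (κ i) else 0) •
        mahlerCoeff f ν) (fun i => ∑ l, κ i l + γ i) fun ν hν => by
    obtain ⟨i, hi⟩ := Function.ne_iff.1 hν
    rw [Finset.prod_eq_zero (Finset.mem_univ i) (if_neg (Ne.symm hi)), zero_smul]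
  have h5 := h2.unique h4
  simp only [if_true] at h5
  rw [← h5]
  exact Finset.sum_congr rfl fun lam _ => (Int.cast_smul_eq_zsmul _ _ _).symm

omit [DecidableEq ι] in
theorem exists_le_prod_stepCoeff (p : ℕ) [Fact p.Prime] (β : ι → ℕ) :
    ∃ C : ℝ, 0 < C ∧ ∀ ν : ι → ℕ, ∃ γ : ι → ℕ, γ ≤ β ∧
      ∃ κ : (i : ι) → Fin (γ i + 1) → ℕ, (ν = fun i => ∑ l, κ i l + γ i) ∧
        C * (powWeight β ν : ℝ) ≤ ‖∏ i, stepCoeff p (γ i) (κ i)‖ := by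
  choose C hC h using exists_le_stepCoeff p
  refine ⟨∏ i, C (β i), Finset.prod_pos fun i _ => hC _, fun ν => ?_⟩
  choose γ hγ κ hκ hκC using fun i => h (β i) (ν i)
  refine ⟨γ, hγ, κ, funext fun i => (hκ i).symm, ?_⟩
  rw [norm_prod, powWeight, NNReal.coe_prod, ← Finset.prod_mul_distrib]
  refine Finset.prod_le_prod (fun i _ => ?_) fun i _ => by simpa using hκC i
  have := (hC (β i)).le
  positivity

/-- The weighted Mahler coefficients are controlled by Newton coefficients of the extended
difference quotients. -/
theorem exists_const_mul_mahlerCoeff_le (p : ℕ) [Fact p.Prime] [Module ℚ_[p] E]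
    [ContinuousSMul ℚ_[p] E] (β : ι → ℕ) : ∃ C : ℝ, 0 < C ∧ ∀ {f : zpPow p ι → E}
      {F : (γ : ι → ℕ) → C(dqDomain (zpPow p ι) γ, E)},
      (∀ γ ≤ β, IsDQExtension f γ (F γ)) → ∀ (q : Seminorm ℚ_[p] E) (ν : ι → ℕ),
      ∃ γ : ι → ℕ, γ ≤ β ∧ ∃ κ : (i : ι) → Fin (γ i + 1) → ℕ, (ν = fun i => ∑ l, κ i l + γ i) ∧
        C * ((powWeight β ν : ℝ) * q (mahlerCoeff f ν)) ≤
          q (newtonCoeff (fun lam => F γ (stepMap p γ fun i l => (lam i l : ℤ_[p]))) κ) := by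
  obtain ⟨C, hC, h⟩ := exists_le_prod_stepCoeff p β
  refine ⟨C, hC, fun {f F} hF q ν => ?_⟩
  obtain ⟨γ, hγ, κ, hκ, hle⟩ := h ν
  refine ⟨γ, hγ, κ, hκ, ?_⟩
  rw [newtonCoeff_dqExtension (hF γ hγ), map_smul_eq_mul, ← mul_assoc, ← hκ]
  exact mul_le_mul_of_nonneg_right hle (apply_nonneg _ _)

end StepMap

/-! ### Decay of the weighted Mahler coefficients -/

section Decay

variable {p : ℕ} [Fact p.Prime] {ι : Type*} [Fintype ι] [DecidableEq ι]
  {E : Type*} [AddCommGroup E] [Module ℚ_[p] E] [UniformSpace E] [IsUniformAddGroup E]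
  [ContinuousSMul ℚ_[p] E] [T2Space E]

/-- A large weighted coefficient forces a large Newton coefficient for some γ ≤ β; there are
finitely many such γ, and finitely many such κ for each. -/
theorem exists_mahlerCoeff_lt {β : ι → ℕ} {f : zpPow p ι → E}
    {F : (γ : ι → ℕ) → C(dqDomain (zpPow p ι) γ, E)} (hF : ∀ γ ≤ β, IsDQExtension f γ (F γ))
    {q : Seminorm ℚ_[p] E} (hq : Continuous q) (hq' : IsNonarchimedean q) {ε : ℝ} (hε : 0 < ε) :
    ∃ Φ : Finset (ι → ℕ), ∀ ν ∉ Φ, (powWeight β ν : ℝ) * q (mahlerCoeff f ν) < ε := by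
  obtain ⟨C, hC, h⟩ := exists_const_mul_mahlerCoeff_le (E := E) p β
  have hfin : ∀ γ : ι → ℕ, ((fun (κ : (i : ι) → Fin (γ i + 1) → ℕ) i => ∑ l, κ i l + γ i) ''
      {κ | C * ε ≤ q (newtonCoeff
        (fun lam => F γ (stepMap p γ fun i l => (lam i l : ℤ_[p]))) κ)}).Finite := fun γ =>
    (finite_newtonCoeff_ge hq hq' ((F γ).continuous.comp (stepMap p γ).continuous)
      (mul_pos hC hε)).image _
  refine ⟨(Finset.Iic β).biUnion fun γ => (hfin γ).toFinset, fun ν hν => ?_⟩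
  by_contra! hcon
  obtain ⟨γ, hγ, κ, hκ, hle⟩ := h hF q ν
  refine hν (Finset.mem_biUnion.2 ⟨γ, Finset.mem_Iic.2 hγ, ?_⟩)
  rw [Set.Finite.mem_toFinset]
  exact ⟨κ, (mul_le_mul_of_nonneg_left hcon hC.le).trans hle, hκ.symm⟩

end Decay

/-! ### Mahler series -/

section MahlerSeries

variable {p : ℕ} [Fact p.Prime] {ι : Type*} [Fintype ι] [DecidableEq ι]

/-- The coordinates in `ℤ_p` of a point of `V^{<γ>}`, for `V ⊆ ℤ_p^ι`. -/
def dqCoord {V : Set (ι → ℚ_[p])} (hV : V ⊆ zpPow p ι) (γ : ι → ℕ) (x : dqDomain V γ) (i : ι)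
    (l : Fin (γ i + 1)) : ℤ_[p] :=
  ⟨x.1 i l, by
    -- The selection taking entry `l` in coordinate `i` and entry 0 elsewhere exhibits `x.1 i l` as
    -- a coordinate of a point of V.
    have h := hV (x.2 (Function.update (fun _ => 0) i l)) i
    rw [Function.update_self] at h
    exact h⟩

omit [Fintype ι] in
theorem continuous_dqCoord {V : Set (ι → ℚ_[p])} (hV : V ⊆ zpPow p ι) (γ : ι → ℕ) (i : ι) :
    Continuous fun x => dqCoord hV γ x i :=
  continuous_pi fun l => Continuous.subtype_mk (f := fun x : dqDomain V γ => x.1 i l)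
    ((continuous_apply l).comp ((continuous_apply i).comp continuous_subtype_val)) _

/-- The difference quotient of a product of binomial coefficients, extended to `V^{<γ>}`. -/
def prodBinomDQ {V : Set (ι → ℚ_[p])} (hV : V ⊆ zpPow p ι) (γ ν : ι → ℕ) (x : dqDomain V γ) :
    ℚ_[p] :=
  ∏ i, binomDQ (γ i) (ν i) (stepDiffs (γ i) (dqCoord hV γ x i))

theorem continuous_prodBinomDQ {V : Set (ι → ℚ_[p])} (hV : V ⊆ zpPow p ι) (γ ν : ι → ℕ) :
    Continuous (prodBinomDQ hV γ ν) :=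
  continuous_finsetProd _ fun i _ => (continuous_binomDQ (γ i) (ν i)).comp
    ((continuous_stepDiffs (γ i)).comp (continuous_dqCoord hV γ i))

theorem norm_prodBinomDQ_le {V : Set (ι → ℚ_[p])} (hV : V ⊆ zpPow p ι) (γ ν : ι → ℕ)
    (x : dqDomain V γ) : ‖prodBinomDQ hV γ ν x‖ ≤ (powWeight γ ν : ℝ) := by
  rw [prodBinomDQ, norm_prod, powWeight, NNReal.coe_prod]
  exact Finset.prod_le_prod (fun i _ => norm_nonneg _) fun i _ => by
    simpa using norm_binomDQ_le (γ i) (ν i) _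

theorem prodBinomDQ_eq_prod_divDiff {V : Set (ι → ℚ_[p])} (hV : V ⊆ zpPow p ι) (γ ν : ι → ℕ)
    {x : dqDomain V γ} (hx : x ∈ dqOffDiag V γ) :
    prodBinomDQ hV γ ν x = ∏ i, divDiff (x.1 i)
      fun l => ((Ring.choose (dqCoord hV γ x i l) (ν i) : ℤ_[p]) : ℚ_[p]) := by
  refine Finset.prod_congr rfl fun i _ => ?_
  have hinj : Function.Injective (stepPoints (γ i) (stepDiffs (γ i) (dqCoord hV γ x i))) := by
    rw [stepPoints_stepDiffs]
    exact fun a b hab => hx i (congrArg Subtype.val hab)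
  rw [← divDiff_choose _ _ _ hinj]
  simp only [stepPoints_stepDiffs]
  rfl

/-- The product of binomial coefficients, as a function on `ℤ_p^ι`. -/
def prodChoose (ν : ι → ℕ) (x : zpPow p ι) : ℚ_[p] :=
  ∏ i, ((Ring.choose (⟨x.1 i, x.2 i⟩ : ℤ_[p]) (ν i) : ℤ_[p]) : ℚ_[p])

omit [DecidableEq ι] in
theorem norm_prodChoose_le (ν : ι → ℕ) (x : zpPow p ι) : ‖prodChoose ν x‖ ≤ 1 := by
  rw [prodChoose, norm_prod]
  exact Finset.prod_le_one (fun i _ => norm_nonneg _) fun i _ => PadicInt.norm_le_one _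

omit [DecidableEq ι] in
theorem prodChoose_natPoint (ν μ : ι → ℕ) :
    prodChoose ν (natPoint p μ) = ∏ i, ((μ i).choose (ν i) : ℚ_[p]) := by
  refine Finset.prod_congr rfl fun i _ => ?_
  have : (⟨(natPoint p μ).1 i, (natPoint p μ).2 i⟩ : ℤ_[p]) = (μ i : ℤ_[p]) :=
    Subtype.ext (PadicInt.coe_natCast _).symm
  rw [this, Ring.choose_natCast, PadicInt.coe_natCast]

/-- The condition that `w_γ(ν) q(b_ν) → 0` for all continuous ultrametric seminorms `q`. -/
def WeightedNull (p : ℕ) [Fact p.Prime] {E : Type*} [AddCommGroup E] [Module ℚ_[p] E]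
    [TopologicalSpace E] (γ : ι → ℕ) (b : (ι → ℕ) → E) : Prop :=
  ∀ q : Seminorm ℚ_[p] E, Continuous q → IsNonarchimedean q → ∀ ε : ℝ, 0 < ε →
    ∃ Φ : Finset (ι → ℕ), ∀ ν ∉ Φ, (powWeight γ ν : ℝ) * q (b ν) < ε

variable {E : Type*} [AddCommGroup E] [Module ℚ_[p] E] [UniformSpace E] [IsUniformAddGroup E]
  [ContinuousSMul ℚ_[p] E]

/-- The sum of a Mahler series. -/
def mahlerSum (p : ℕ) [Fact p.Prime] [Module ℚ_[p] E] (b : (ι → ℕ) → E) (x : zpPow p ι) : E :=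
  ∑' ν, prodChoose ν x • b ν

theorem WeightedNull.summable_prodBinomDQ (hconv : IsUltraLocallyConvex ℚ_[p] E)
    (hcomplete : ∀ u : ℕ → E, CauchySeq u → ∃ a, Tendsto u atTop (𝓝 a)) {γ : ι → ℕ}
    {b : (ι → ℕ) → E} (hb : WeightedNull p γ b) {V : Set (ι → ℚ_[p])} (hV : V ⊆ zpPow p ι)
    (x : dqDomain V γ) : Summable fun ν => prodBinomDQ hV γ ν x • b ν := by
  refine hconv.summable hcomplete fun q hq hq' ε hε => ?_
  obtain ⟨Φ, hΦ⟩ := hb q hq hq' ε hε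
  refine ⟨Φ, fun ν hν => lt_of_le_of_lt ?_ (hΦ ν hν)⟩
  rw [map_smul_eq_mul]
  exact mul_le_mul_of_nonneg_right (norm_prodBinomDQ_le hV γ ν x) (apply_nonneg _ _)

omit [DecidableEq ι] in
theorem WeightedNull.hasSum_mahlerSum (hconv : IsUltraLocallyConvex ℚ_[p] E)
    (hcomplete : ∀ u : ℕ → E, CauchySeq u → ∃ a, Tendsto u atTop (𝓝 a))
    {b : (ι → ℕ) → E} (hb : WeightedNull p 0 b) (x : zpPow p ι) :
    HasSum (fun ν => prodChoose ν x • b ν) (mahlerSum p b x) := by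
  refine (hconv.summable hcomplete fun q hq hq' ε hε => ?_).hasSum
  obtain ⟨Φ, hΦ⟩ := hb q hq hq' ε hε
  refine ⟨Φ, fun ν hν => lt_of_le_of_lt ?_ (hΦ ν hν)⟩
  rw [map_smul_eq_mul]
  exact mul_le_mul_of_nonneg_right ((norm_prodChoose_le ν x).trans (by simp [powWeight]))
    (apply_nonneg _ _)

variable [T2Space E]

/-- The extended difference quotient of a Mahler series. -/
def WeightedNull.dqSum (hconv : IsUltraLocallyConvex ℚ_[p] E)
    (hcomplete : ∀ u : ℕ → E, CauchySeq u → ∃ a, Tendsto u atTop (𝓝 a)) {γ : ι → ℕ}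
    {b : (ι → ℕ) → E} (hb : WeightedNull p γ b) {V : Set (ι → ℚ_[p])} (hV : V ⊆ zpPow p ι) :
    C(dqDomain V γ, E) where
  toFun x := ∑' ν, prodBinomDQ hV γ ν x • b ν
  continuous_toFun := by
    refine hconv.continuous_tsum (fun ν => (continuous_prodBinomDQ hV γ ν).smul continuous_const)
      (hb.summable_prodBinomDQ hconv hcomplete hV) fun q hq hq' ε hε => ?_
    obtain ⟨Φ, hΦ⟩ := hb q hq hq' ε hε
    refine ⟨Φ, fun ν hν x => lt_of_le_of_lt ?_ (hΦ ν hν)⟩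
    rw [map_smul_eq_mul]
    exact mul_le_mul_of_nonneg_right (norm_prodBinomDQ_le hV γ ν x) (apply_nonneg _ _)

/-- The weight 0 hypothesis makes the Mahler series itself converge, the weight γ hypothesis its
term-by-term difference quotient. -/
theorem WeightedNull.isDQExtension_dqSum (hconv : IsUltraLocallyConvex ℚ_[p] E)
    (hcomplete : ∀ u : ℕ → E, CauchySeq u → ∃ a, Tendsto u atTop (𝓝 a)) {γ : ι → ℕ}
    {b : (ι → ℕ) → E} (hb0 : WeightedNull p 0 b) (hb : WeightedNull p γ b)
    {V : Set (ι → ℚ_[p])} (hV : V ⊆ zpPow p ι) :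
    IsDQExtension (mahlerSum p b ∘ Set.inclusion hV) γ (hb.dqSum hconv hcomplete hV) := by
  intro x hx
  have hpc : ∀ (ν : ι → ℕ) (j : (i : ι) → Fin (γ i + 1)),
      prodChoose ν (Set.inclusion hV ⟨fun i => x.1 i (j i), x.2 j⟩) =
        ∏ i, ((Ring.choose (dqCoord hV γ x i (j i)) (ν i) : ℤ_[p]) : ℚ_[p]) := fun _ _ => rfl
  have h := hasSum_diffQuot (f := mahlerSum p b ∘ Set.inclusion hV) x
    (fun (ν : ι → ℕ) i l => ((Ring.choose (dqCoord hV γ x i l) (ν i) : ℤ_[p]) : ℚ_[p])) b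
    fun j => by
      have := hb0.hasSum_mahlerSum hconv hcomplete
        (Set.inclusion hV ⟨fun i => x.1 i (j i), x.2 j⟩)
      simp only [hpc] at this
      exact this
  simp only [← prodBinomDQ_eq_prod_divDiff hV γ _ hx] at h
  exact h.tsum_eq

theorem WeightedNull.seminorm_dqSum_sub_le (hconv : IsUltraLocallyConvex ℚ_[p] E)
    (hcomplete : ∀ u : ℕ → E, CauchySeq u → ∃ a, Tendsto u atTop (𝓝 a)) {γ : ι → ℕ}
    {b c : (ι → ℕ) → E} (hb : WeightedNull p γ b) (hc : WeightedNull p γ c)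
    {V : Set (ι → ℚ_[p])} (hV : V ⊆ zpPow p ι) {q : Seminorm ℚ_[p] E} (hq : Continuous q)
    (hq' : IsNonarchimedean q) {ε : ℝ} (hε : 0 ≤ ε)
    (h : ∀ ν, (powWeight γ ν : ℝ) * q (b ν - c ν) ≤ ε) (x : dqDomain V γ) :
    q (hb.dqSum hconv hcomplete hV x - hc.dqSum hconv hcomplete hV x) ≤ ε := by
  have hsum := (hb.summable_prodBinomDQ hconv hcomplete hV x).hasSum.sub
    (hc.summable_prodBinomDQ hconv hcomplete hV x).hasSum
  refine seminorm_hasSum_le hq hq' hsum hε fun ν => ?_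
  rw [← smul_sub, map_smul_eq_mul]
  exact (mul_le_mul_of_nonneg_right (norm_prodBinomDQ_le hV γ ν x) (apply_nonneg _ _)).trans (h ν)

/-- A Mahler coefficient involves finitely many values, so it can be taken termwise, where Newton
signs and binomials are inverse to each other. -/
theorem WeightedNull.mahlerCoeff_mahlerSum (hconv : IsUltraLocallyConvex ℚ_[p] E)
    (hcomplete : ∀ u : ℕ → E, CauchySeq u → ∃ a, Tendsto u atTop (𝓝 a))
    {b : (ι → ℕ) → E} (hb : WeightedNull p 0 b) (ν : ι → ℕ) :
    mahlerCoeff (mahlerSum p b) ν = b ν := by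
  have h1 := hasSum_sum fun μ (_ : μ ∈ Finset.Iic ν) =>
    (hb.hasSum_mahlerSum hconv hcomplete (natPoint p μ)).const_smul
      ((∏ i, newtonSign (ν i) (μ i) : ℤ) : ℚ_[p])
  have h2 : ∀ m : ι → ℕ, ∑ μ ∈ Finset.Iic ν, ((∏ i, newtonSign (ν i) (μ i) : ℤ) : ℚ_[p]) •
      (prodChoose m (natPoint p μ) • b m) = (if ν = m then (1 : ℚ_[p]) else 0) • b m := fun m => by
    simp only [smul_smul, ← Finset.sum_smul]
    congr 1
    have h3 : ∀ μ : ι → ℕ, ((∏ i, newtonSign (ν i) (μ i) : ℤ) : ℚ_[p]) *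
        prodChoose m (natPoint p μ) =
        ((∏ i, newtonSign (ν i) (μ i) * ((μ i).choose (m i) : ℤ) : ℤ) : ℚ_[p]) := fun μ => by
      rw [prodChoose_natPoint, Finset.prod_mul_distrib]
      push_cast
      rfl
    simp only [h3]
    rw [← Int.cast_sum, sum_Iic_prod ν fun i c => newtonSign (ν i) c * (c.choose (m i) : ℤ)]
    simp only [sum_newtonSign_mul_choose]
    split_ifs with h
    · simp [h]
    · obtain ⟨i, hi⟩ := Function.ne_iff.1 h
      rw [Finset.prod_eq_zero (Finset.mem_univ i) (if_neg hi), Int.cast_zero]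
  simp only [h2] at h1
  have h4 := hasSum_single (f := fun m : ι → ℕ => (if ν = m then (1 : ℚ_[p]) else 0) • b m) ν
    fun m hm => by rw [if_neg hm.symm, zero_smul]
  have h5 := h1.unique h4
  rw [if_pos rfl, one_smul] at h5
  rw [← h5, mahlerCoeff_eq_sum_newtonSign]
  exact Finset.sum_congr rfl fun μ _ => (Int.cast_smul_eq_zsmul _ _ _).symm

end MahlerSeries

/-! ### Density -/

section Density

theorem dense_biInter_finset {X T : Type*} [TopologicalSpace X] (s : Finset T) {A : T → Set X}
    (ho : ∀ t, IsOpen (A t)) (hd : ∀ t, Dense (A t)) : Dense (⋂ t ∈ s, A t) := by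
  classical
  induction s using Finset.induction_on with
  | empty => simp
  | insert t s _ ih =>
    rw [Finset.set_biInter_insert]
    exact (hd t).inter_of_isOpen_left ih (ho t)

variable {K ι : Type*} [TopologicalSpace K] [T2Space K]

/-- A finite intersection of open dense sets, one for each pair of entries in the same coordinate.
Two equal entries are separated by moving one of them within its factor of V, which has no isolated
points; the product form keeps the moved point in V^{<β>}. -/
theorem dense_dqOffDiag [Finite ι] {V : Set (ι → K)} (hV : IsCartesian V) (β : ι → ℕ) :
    Dense (dqOffDiag V β) := by
  classical
  have := Fintype.ofFinite ι
  let T := {t : Σ i, Fin (β i + 1) × Fin (β i + 1) // t.2.1 ≠ t.2.2}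
  let A : T → Set (dqDomain V β) := fun t => {x | x.1 t.1.1 t.1.2.1 ≠ x.1 t.1.1 t.1.2.2}
  have hA : (⋂ t ∈ (Finset.univ : Finset T), A t) ⊆ dqOffDiag V β := by
    intro x hx i j k hjk
    by_contra hne
    simp only [Set.mem_iInter] at hx
    exact hx ⟨⟨i, j, k⟩, hne⟩ (Finset.mem_univ _) hjk
  have hcont : ∀ i j, Continuous fun x : dqDomain V β => x.1 i j := fun i j =>
    (continuous_apply j).comp ((continuous_apply i).comp continuous_subtype_val)
  refine (dense_biInter_finset Finset.univ (fun t => ?_) fun t => ?_).mono hA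
  · exact isOpen_ne_fun (hcont _ _) (hcont _ _)
  · obtain ⟨⟨i, j, k⟩, hjk⟩ := t
    intro x
    by_cases hx : x.1 i j = x.1 i k
    · obtain ⟨W, hW, rfl⟩ := hV
      have hxW : ∀ i j, x.1 i j ∈ W i := fun i j => by
        have h := x.2 (Function.update (fun _ => 0) i j) i (Set.mem_univ i)
        beta_reduce at h
        rwa [Function.update_self] at h
      have hmem : ∀ w ∈ W i, ∀ i' l,
          Function.update x.1 i (Function.update (x.1 i) j w) i' l ∈ W i' := fun w hw i' l => by
        rcases eq_or_ne i' i with rfl | hi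
        · rw [Function.update_self]
          rcases eq_or_ne l j with rfl | hl
          · rwa [Function.update_self]
          · rw [Function.update_of_ne hl]; exact hxW _ _
        · rw [Function.update_of_ne hi]; exact hxW _ _
      have hacc : (𝓝[≠] (x.1 i j) ⊓ 𝓟 (W i)).NeBot := hW i _ (hxW i j)
      refine closure_subtype.2 ?_
      refine mem_closure_of_tendsto (b := 𝓝[≠] (x.1 i j) ⊓ 𝓟 (W i))
        (f := fun w => Function.update x.1 i (Function.update (x.1 i) j w)) ?_ ?_
      · have hc : Continuous fun w => Function.update x.1 i (Function.update (x.1 i) j w) :=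
          continuous_const.update i (continuous_const.update j continuous_id)
        have h := hc.tendsto (x.1 i j)
        rw [Function.update_eq_self, Function.update_eq_self] at h
        exact h.mono_left (inf_le_left.trans nhdsWithin_le_nhds)
      · have h1 : ∀ᶠ w in 𝓝[≠] (x.1 i j) ⊓ 𝓟 (W i), w ≠ x.1 i j :=
          Eventually.filter_mono inf_le_left self_mem_nhdsWithin
        have h2 : ∀ᶠ w in 𝓝[≠] (x.1 i j) ⊓ 𝓟 (W i), w ∈ W i :=
          Eventually.filter_mono inf_le_right (mem_principal_self _)
        filter_upwards [h1, h2] with w hw hwW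
        refine ⟨⟨_, fun j' i' _ => hmem w hwW i' (j' i')⟩, ?_, rfl⟩
        · change Function.update x.1 i (Function.update (x.1 i) j w) i j ≠
            Function.update x.1 i (Function.update (x.1 i) j w) i k
          rw [Function.update_self, Function.update_self, Function.update_of_ne hjk.symm, ← hx]
          exact hw
    · exact subset_closure hx

variable {p : ℕ} [Fact p.Prime]

theorem preperfect_padicInt_subring : Preperfect (PadicInt.subring p : Set ℚ_[p]) := by
  have h : Preperfect (Set.univ : Set ℚ_[p]) := PerfectSpace.univ_preperfect
  have ho : IsOpen (PadicInt.subring p : Set ℚ_[p]) := by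
    have : (PadicInt.subring p : Set ℚ_[p]) = Metric.closedBall 0 1 := by
      ext x; rw [mem_closedBall_zero_iff]; rfl
    rw [this]
    exact IsUltrametricDist.isOpen_closedBall _ one_ne_zero
  simpa using h.open_inter ho

/-- `ℤ_p^ι` as a cartesian open subset of itself. -/
def zpCartesianOpen (p : ℕ) [Fact p.Prime] (ι : Type*) : CartesianOpen (zpPow p ι) where
  carrier := zpPow p ι
  subset := subset_rfl
  isOpen := by simp
  isCartesian := ⟨fun _ => PadicInt.subring p, fun _ => preperfect_padicInt_subring, by
    ext x; simp [zpPow]⟩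

theorem denseRange_natPoint : DenseRange (natPoint p : (ι → ℕ) → zpPow p ι) := by
  let φ : (ι → ℤ_[p]) → zpPow p ι := fun y => ⟨fun i => (y i : ℚ_[p]), fun i => (y i).2⟩
  have hφ : Continuous φ := Continuous.subtype_mk
    (continuous_pi fun i => continuous_subtype_val.comp (continuous_apply i)) _
  have hs : Function.Surjective φ := fun x => ⟨fun i => ⟨x.1 i, x.2 i⟩, rfl⟩
  have hd : DenseRange fun (μ : ι → ℕ) i => (μ i : ℤ_[p]) :=
    DenseRange.piMap fun _ => PadicInt.denseRange_natCast
  have h := hs.denseRange.comp hd hφ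
  have heq : (φ ∘ fun (μ : ι → ℕ) i => (μ i : ℤ_[p])) = natPoint p :=
    funext fun μ => Subtype.ext (funext fun i => PadicInt.coe_natCast _)
  rwa [heq] at h

end Density

/-! ### The isomorphism with the weighted `c₀`-space -/

section CAlpha

variable {p : ℕ} [Fact p.Prime] {ι : Type*} [Fintype ι] [DecidableEq ι]

section Continuity

variable {E : Type*} [AddCommGroup E] [Module ℚ_[p] E] [TopologicalSpace E]

theorem continuous_of_isDQExtension_zero {f : zpPow p ι → E}
    {F : C(dqDomain (zpPow p ι) 0, E)} (hF : IsDQExtension f 0 F) : Continuous f := by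
  have hsub : ∀ i : ι, Subsingleton (Fin ((0 : ι → ℕ) i + 1)) := fun _ =>
    inferInstanceAs (Subsingleton (Fin 1))
  let e : zpPow p ι → dqDomain (zpPow p ι) 0 := fun x => ⟨fun i _ => x.1 i, fun _ => x.2⟩
  have he : Continuous e := Continuous.subtype_mk
    (f := fun (x : zpPow p ι) (i : ι) (_ : Fin ((0 : ι → ℕ) i + 1)) => x.1 i)
    (continuous_pi fun i => continuous_pi fun _ =>
      (continuous_apply i).comp continuous_subtype_val) _
  have hfe : f = F ∘ e := by
    funext x
    rw [Function.comp_apply, hF (e x) fun i => Function.injective_of_subsingleton _, diffQuot,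
      Fintype.sum_subsingleton _ fun i => (0 : Fin ((0 : ι → ℕ) i + 1))]
    have h1 : ∀ i : ι, ∏ k ∈ Finset.univ.erase (0 : Fin ((0 : ι → ℕ) i + 1)),
        ((e x).1 i 0 - (e x).1 i k)⁻¹ = 1 := fun i =>
      Finset.prod_eq_one fun k hk =>
        absurd (Subsingleton.elim _ _) (Finset.ne_of_mem_erase hk)
    rw [Finset.prod_congr rfl fun i _ => h1 i]
    simp [e]
  rw [hfe]
  exact F.continuous.comp he

theorem IsCAlpha.continuous {α : ι → ℕ∞} {f : zpPow p ι → E} (hf : IsCAlpha α f) :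
    Continuous f := by
  obtain ⟨F, hF⟩ := hf (zpCartesianOpen p ι) 0 fun i => by simp
  exact continuous_of_isDQExtension_zero hF

omit [Module ℚ_[p] E] in
-- Mahler coefficients determine the values at natural points, which are dense.
theorem eq_of_mahlerCoeff_eq [T2Space E] {f g : zpPow p ι → E} (hf : Continuous f)
    (hg : Continuous g) (h : ∀ ν, mahlerCoeff f ν = mahlerCoeff g ν) : f = g := by
  refine denseRange_natPoint.equalizer hf hg (funext fun x => ?_)
  simp only [Function.comp_apply]
  rw [← sum_choose_smul_mahlerCoeff f, ← sum_choose_smul_mahlerCoeff g]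
  simp only [h]

theorem absAtTop_eq_cofinite : absAtTop ι = cofinite := by
  ext s
  rw [absAtTop, mem_comap, mem_cofinite]
  constructor
  · rintro ⟨t, ht, hts⟩
    obtain ⟨N, hN⟩ := mem_atTop_sets.1 ht
    refine (Finset.Iic fun _ : ι => N).finite_toSet.subset fun ν hν => ?_
    rw [Finset.mem_coe, Finset.mem_Iic]
    intro i
    by_contra hcon
    exact hν (hts (hN _ ((not_le.1 hcon).le.trans
      (Finset.single_le_sum (fun _ _ => Nat.zero_le _) (Finset.mem_univ i)))))
  · intro hs
    obtain ⟨N, hN⟩ := (hs.image fun ν : ι → ℕ => ∑ i, ν i).bddAbove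
    refine ⟨Set.Ioi N, Ioi_mem_atTop N, fun ν hν => ?_⟩
    by_contra hcon
    exact absurd (hN ⟨ν, hcon, rfl⟩) (not_le.2 hν)

theorem weightedNull_iff_tendsto {β : ι → ℕ} {b : (ι → ℕ) → E} :
    WeightedNull p β b ↔ ∀ q : Seminorm ℚ_[p] E, Continuous q → IsNonarchimedean q →
      Tendsto (fun ν => q (b ν) * (powWeight β ν : ℝ)) (absAtTop ι) (𝓝 0) := by
  refine forall_congr' fun q => forall_congr' fun _ => forall_congr' fun _ => ?_
  rw [absAtTop_eq_cofinite, Metric.tendsto_nhds]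
  refine forall_congr' fun ε => forall_congr' fun _ => ?_
  have habs : ∀ ν, dist (q (b ν) * (powWeight β ν : ℝ)) 0 = (powWeight β ν : ℝ) * q (b ν) :=
    fun ν => by
      rw [Real.dist_0_eq_abs, abs_of_nonneg (mul_nonneg (apply_nonneg _ _) (NNReal.coe_nonneg _)),
        mul_comm]
  simp only [habs, eventually_cofinite]
  constructor
  · rintro ⟨Φ, hΦ⟩
    exact Φ.finite_toSet.subset fun ν hν => by
      by_contra h
      exact hν (hΦ ν h)
  · intro h
    exact ⟨h.toFinset, fun ν hν => by simpa using hν⟩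

end Continuity

variable {E : Type*} [AddCommGroup E] [Module ℚ_[p] E] [UniformSpace E] [IsUniformAddGroup E]
  [ContinuousSMul ℚ_[p] E] [T2Space E]

theorem IsCAlpha.weightedNull {β : ι → ℕ} {f : zpPow p ι → E}
    (hf : IsCAlpha (fun i => (β i : ℕ∞)) f) : WeightedNull p β (mahlerCoeff f) := by
  classical
  intro q hq hq' ε hε
  have h : ∀ γ : ι → ℕ, ∃ F : C(dqDomain (zpPow p ι) γ, E), γ ≤ β → IsDQExtension f γ F :=
    fun γ => by
      by_cases hγ : γ ≤ β
      · obtain ⟨F, hF⟩ := hf (zpCartesianOpen p ι) γ fun i => Nat.cast_le.2 (hγ i)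
        exact ⟨F, fun _ => hF⟩
      · exact ⟨0, fun h => absurd h hγ⟩
  choose F hF using h
  exact exists_mahlerCoeff_lt hF hq hq' hε

theorem isCAlpha_mahlerSum (hconv : IsUltraLocallyConvex ℚ_[p] E)
    (hcomplete : ∀ u : ℕ → E, CauchySeq u → ∃ a, Tendsto u atTop (𝓝 a))
    {β : ι → ℕ} {b : (ι → ℕ) → E} (hb : ∀ γ ≤ β, WeightedNull p γ b) :
    IsCAlpha (fun i => (β i : ℕ∞)) (mahlerSum p b) := fun V γ hγ =>
  ⟨_, (hb 0 fun _ => Nat.zero_le _).isDQExtension_dqSum hconv hcomplete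
    (hb γ fun i => Nat.cast_le.1 (hγ i)) V.subset⟩

omit [T2Space E] in
theorem cAlphaDelta_spec {α : ι → ℕ∞} (V : CartesianOpen (zpPow p ι))
    (γ : {γ : ι → ℕ // ∀ i, (γ i : ℕ∞) ≤ α i}) (f : CAlphaSpace (zpPow p ι) E α) :
    IsDQExtension (f.1 ∘ Set.inclusion V.subset) γ.1 (cAlphaDelta V γ f) :=
  (f.2 V γ.1 γ.2).choose_spec

omit [IsUniformAddGroup E] [ContinuousSMul ℚ_[p] E] [Module ℚ_[p] E] in
-- This makes the choice in `cAlphaDelta` harmless and identifies it with `dqSum` on Mahler series.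
theorem IsDQExtension.unique {K : Type*} [Field K] [Module K E] [TopologicalSpace K] [T2Space K]
    {V : Set (ι → K)} (hV : IsCartesian V) {f : V → E} {γ : ι → ℕ} {F G : C(dqDomain V γ, E)}
    (hF : IsDQExtension f γ F) (hG : IsDQExtension f γ G) : F = G :=
  DFunLike.coe_injective (Continuous.ext_on (dense_dqOffDiag hV γ) F.continuous G.continuous
    fun x hx => (hF x hx).trans (hG x hx).symm)

end CAlpha

/-! ### The Mahler isomorphism for block orders α -/

section Blocks

variable {p : ℕ} [Fact p.Prime] {l : ℕ} {n : Fin l → ℕ} {α : Fin l → ℕ∞}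

theorem zero_mem_blockIndices : (0 : (Σ j, Fin (n j)) → ℕ) ∈ blockIndices n α := fun j => by simp

theorem blockIndices_mono {β γ : (Σ j, Fin (n j)) → ℕ} (hβ : β ∈ blockIndices n α) (h : γ ≤ β) :
    γ ∈ blockIndices n α := fun j =>
  le_trans (by exact_mod_cast Finset.sum_le_sum fun k _ => h ⟨j, k⟩) (hβ j)

variable {E : Type*} [AddCommGroup E] [Module ℚ_[p] E] [UniformSpace E] [IsUniformAddGroup E]
  [ContinuousSMul ℚ_[p] E] [T2Space E]

omit [IsUniformAddGroup E] [ContinuousSMul ℚ_[p] E] [T2Space E] in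
theorem IsBlockCAlpha.continuous {f : zpPow p (Σ j, Fin (n j)) → E} (hf : IsBlockCAlpha α f) :
    Continuous f :=
  (hf 0 zero_mem_blockIndices).continuous

theorem isBlockCAlpha_mahlerSum (hconv : IsUltraLocallyConvex ℚ_[p] E)
    (hcomplete : ∀ u : ℕ → E, CauchySeq u → ∃ a, Tendsto u atTop (𝓝 a))
    {b : ((Σ j, Fin (n j)) → ℕ) → E} (hb : ∀ β ∈ blockIndices n α, WeightedNull p β b) :
    IsBlockCAlpha α (mahlerSum p b) := fun _ hβ =>
  isCAlpha_mahlerSum hconv hcomplete fun γ hγ => hb γ (blockIndices_mono hβ hγ)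

/-- For the converse, the Mahler series with coefficients `mahlerCoeff f` has a `C^α` sum, which
coincides with f by continuity and equality of coefficients. -/
theorem isBlockCAlpha_iff (hconv : IsUltraLocallyConvex ℚ_[p] E)
    (hcomplete : ∀ u : ℕ → E, CauchySeq u → ∃ a, Tendsto u atTop (𝓝 a))
    {f : zpPow p (Σ j, Fin (n j)) → E} (hf : Continuous f) :
    IsBlockCAlpha α f ↔ ∀ β ∈ blockIndices n α, WeightedNull p β (mahlerCoeff f) := by
  refine ⟨fun h β hβ => (h β hβ).weightedNull, fun h => ?_⟩
  have hS := isBlockCAlpha_mahlerSum hconv hcomplete h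
  rwa [← eq_of_mahlerCoeff_eq hf hS.continuous fun ν =>
    ((h 0 zero_mem_blockIndices).mahlerCoeff_mahlerSum hconv hcomplete ν).symm] at hS

omit [IsUniformAddGroup E] [ContinuousSMul ℚ_[p] E] [T2Space E] in
theorem mem_c0Submodule_iff {b : ((Σ j, Fin (n j)) → ℕ) → E} :
    b ∈ c0Submodule ℚ_[p] E (powWeight '' blockIndices n α) ↔
      ∀ β ∈ blockIndices n α, WeightedNull p β b := by
  constructor
  · intro h β hβ q hq hq'
    exact h _ ⟨β, hβ, rfl⟩ ⟨q, hq, hq'⟩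
  · rintro h _ ⟨β, hβ, rfl⟩ q
    exact h β hβ q.1 q.2.1 q.2.2

variable (n α) in
/-- The Mahler coefficients, as a linear isomorphism. -/
def mahlerLinearEquiv (hconv : IsUltraLocallyConvex ℚ_[p] E)
    (hcomplete : ∀ u : ℕ → E, CauchySeq u → ∃ a, Tendsto u atTop (𝓝 a)) :
    BlockCAlphaSpace (zpPow p (Σ j, Fin (n j))) E α ≃ₗ[ℚ_[p]]
      C0Space ℚ_[p] E (powWeight '' blockIndices n α) where
  toFun f := ⟨mahlerCoeff f.1, mem_c0Submodule_iff.2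
    ((isBlockCAlpha_iff hconv hcomplete (IsBlockCAlpha.continuous f.2)).1 f.2)⟩
  map_add' f g := Subtype.ext <| funext fun ν => by
    change mahlerCoeff (f.1 + g.1) ν = mahlerCoeff f.1 ν + mahlerCoeff g.1 ν
    simp [mahlerCoeff, smul_add, Finset.sum_add_distrib]
  map_smul' c f := Subtype.ext <| funext fun ν => by
    change mahlerCoeff (c • f.1) ν = c • mahlerCoeff f.1 ν
    simp only [mahlerCoeff, Pi.smul_apply, Finset.smul_sum]
    exact Finset.sum_congr rfl fun μ _ => smul_comm _ _ _
  invFun b := ⟨mahlerSum p b.1,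
    isBlockCAlpha_mahlerSum hconv hcomplete (mem_c0Submodule_iff.1 b.2)⟩
  left_inv f := Subtype.ext <| by
    have h := (isBlockCAlpha_iff hconv hcomplete (IsBlockCAlpha.continuous f.2)).1 f.2
    exact eq_of_mahlerCoeff_eq (isBlockCAlpha_mahlerSum hconv hcomplete h).continuous
      (IsBlockCAlpha.continuous f.2)
      ((h 0 zero_mem_blockIndices).mahlerCoeff_mahlerSum hconv hcomplete)
  right_inv b := Subtype.ext <| funext <|
    (mem_c0Submodule_iff.1 b.2 0 zero_mem_blockIndices).mahlerCoeff_mahlerSum hconv hcomplete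

omit [IsUniformAddGroup E] [ContinuousSMul ℚ_[p] E] [T2Space E] in
theorem c0Space_withSeminorms {X : Type*} (W : Set (X → ℝ≥0)) [Nonempty W]
    [Nonempty (CtsUltraSeminorm ℚ_[p] E)] :
    WithSeminorms (fun i : W × CtsUltraSeminorm ℚ_[p] E =>
      (C0Space.seminorm i.1 i.2 : Seminorm ℚ_[p] (C0Space ℚ_[p] E W))) :=
  ⟨rfl⟩

omit [T2Space E] in
theorem continuous_cAlphaDelta_incl (β : blockIndices n α)
    (V : CartesianOpen (zpPow p (Σ j, Fin (n j))))
    (γ : {γ : (Σ j, Fin (n j)) → ℕ // ∀ i, (γ i : ℕ∞) ≤ (β.1 i : ℕ∞)}) :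
    Continuous fun f : BlockCAlphaSpace (zpPow p (Σ j, Fin (n j))) E α =>
      cAlphaDelta V γ (BlockCAlphaSpace.incl β f) := by
  have h1 : Continuous (BlockCAlphaSpace.incl (U := zpPow p (Σ j, Fin (n j))) (E := E) β) :=
    continuous_iff_le_induced.2 (iInf_le _ β)
  have h2 : Continuous (cAlphaDelta (E := E) (α := fun i => (β.1 i : ℕ∞)) V γ) :=
    continuous_iff_le_induced.2 ((iInf_le _ V).trans (iInf_le _ γ))
  exact h2.comp h1

omit [T2Space E] in
theorem eventually_seminorm_cAlphaDelta_sub_lt (hconv : IsUltraLocallyConvex ℚ_[p] E)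
    (β : blockIndices n α)
    (γ : {γ : (Σ j, Fin (n j)) → ℕ // ∀ i, (γ i : ℕ∞) ≤ (β.1 i : ℕ∞)})
    {q : Seminorm ℚ_[p] E} (hq : Continuous q) (hq' : IsNonarchimedean q) {ε : ℝ} (hε : 0 < ε)
    (f₀ : BlockCAlphaSpace (zpPow p (Σ j, Fin (n j))) E α) :
    ∀ᶠ f in 𝓝 f₀, ∀ y, q
      (cAlphaDelta (zpCartesianOpen p _) γ (BlockCAlphaSpace.incl β f) (stepMap p γ.1 y) -
        cAlphaDelta (zpCartesianOpen p _) γ (BlockCAlphaSpace.incl β f₀) (stepMap p γ.1 y)) <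
      ε := by
  have h := ((ContinuousMap.continuous_precomp (stepMap p γ.1)).comp
    (continuous_cAlphaDelta_incl (E := E) β (zpCartesianOpen p _) γ)).tendsto f₀
  rw [ContinuousMap.tendsto_iff_tendstoUniformly, ← tendstoUniformlyOn_univ,
    hconv.tendstoUniformlyOn_iff] at h
  exact (h q hq hq' ε hε).mono fun f hf y => hf y (Set.mem_univ y)

/-- Only V = ℤ_p^n and the finitely many γ ≤ β matter. Composed with `stepMap`, whose source is
compact, the quotients of `f - f₀` become uniformly small, hence so do their Newton coefficients;
the constant `C` is independent of f and ν. -/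
theorem continuous_mahlerLinearEquiv (hconv : IsUltraLocallyConvex ℚ_[p] E)
    (hcomplete : ∀ u : ℕ → E, CauchySeq u → ∃ a, Tendsto u atTop (𝓝 a)) :
    Continuous (mahlerLinearEquiv n α hconv hcomplete) := by
  classical
  have : Nonempty (powWeight '' blockIndices n α) := ⟨_, 0, zero_mem_blockIndices, rfl⟩
  obtain ⟨q₀, hq₀, hq₀', -⟩ := hconv.exists_seminorm (U := Set.univ) univ_mem
  have : Nonempty (CtsUltraSeminorm ℚ_[p] E) := ⟨⟨q₀, hq₀, hq₀'⟩⟩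
  rw [continuous_iff_continuousAt]
  intro f₀
  rw [ContinuousAt, (c0Space_withSeminorms (p := p) (E := E) _).tendsto_nhds]
  rintro ⟨⟨_, β, hβ, rfl⟩, q⟩ ε hε
  obtain ⟨C, hC, hle⟩ := exists_const_mul_mahlerCoeff_le (E := E) p β
  have hCε : 0 < C * (ε / 2) := mul_pos hC (half_pos hε)
  have hcast : ∀ {γ : (Σ j, Fin (n j)) → ℕ}, γ ≤ β → ∀ i, (γ i : ℕ∞) ≤ (β i : ℕ∞) :=
    fun h i => Nat.cast_le.2 (h i)
  -- Extended by 0 to orders not below β, to fit the family indexed by all γ.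
  let D (γ : (Σ j, Fin (n j)) → ℕ) (f : BlockCAlphaSpace (zpPow p (Σ j, Fin (n j))) E α) :
      C(dqDomain (zpPow p (Σ j, Fin (n j))) γ, E) :=
    if h : γ ≤ β then cAlphaDelta (zpCartesianOpen p _) ⟨γ, hcast h⟩
      (BlockCAlphaSpace.incl ⟨β, hβ⟩ f) else 0
  have hDeq : ∀ (γ : (Σ j, Fin (n j)) → ℕ) (h : γ ≤ β) f, D γ f =
      cAlphaDelta (zpCartesianOpen p _) ⟨γ, hcast h⟩ (BlockCAlphaSpace.incl ⟨β, hβ⟩ f) :=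
    fun γ h f => dif_pos h
  have hD : ∀ γ ≤ β, ∀ f, IsDQExtension f.1 γ (D γ f) := fun γ hγ f => by
    rw [hDeq γ hγ]
    exact cAlphaDelta_spec (zpCartesianOpen p _) ⟨γ, hcast hγ⟩ (BlockCAlphaSpace.incl ⟨β, hβ⟩ f)
  have hev : ∀ᶠ f in 𝓝 f₀, ∀ γ ∈ Finset.Iic β, ∀ y,
      q.1 (D γ f (stepMap p γ y) - D γ f₀ (stepMap p γ y)) < C * (ε / 2) := by
    rw [Filter.eventually_all_finset]
    intro γ hγ
    simp only [hDeq γ (Finset.mem_Iic.1 hγ)]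
    exact eventually_seminorm_cAlphaDelta_sub_lt hconv ⟨β, hβ⟩
      ⟨γ, hcast (Finset.mem_Iic.1 hγ)⟩ q.2.1 q.2.2 hCε f₀
  filter_upwards [hev] with f hf
  rw [← map_sub]
  refine lt_of_le_of_lt (Real.iSup_le (fun ν => ?_) (half_pos hε).le) (half_lt_self hε)
  have hF : ∀ γ ≤ β, IsDQExtension (f.1 - f₀.1) γ (D γ f - D γ f₀) := fun γ hγ x hx => by
    rw [ContinuousMap.sub_apply, hD γ hγ f x hx, hD γ hγ f₀ x hx, sub_eq_iff_eq_add,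
      ← diffQuot_add, sub_add_cancel]
  obtain ⟨γ, hγ, κ, -, h⟩ := hle hF q.1 ν
  exact le_of_mul_le_mul_left (h.trans (seminorm_newtonCoeff_le q.2.2 _ κ hCε.le fun lam =>
    (hf γ (Finset.mem_Iic.2 hγ) _).le)) hC

/-- The quotient of order γ is bounded on all of V^{<γ>} by the `c_0`-seminorm of weight w_γ, so
compact sets play no role; w_γ is an admissible weight because N_α is closed downwards. -/
theorem continuous_mahlerLinearEquiv_symm (hconv : IsUltraLocallyConvex ℚ_[p] E)
    (hcomplete : ∀ u : ℕ → E, CauchySeq u → ∃ a, Tendsto u atTop (𝓝 a)) :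
    Continuous (mahlerLinearEquiv n α hconv hcomplete).symm := by
  have : Nonempty (powWeight '' blockIndices n α) := ⟨_, 0, zero_mem_blockIndices, rfl⟩
  obtain ⟨q₀, hq₀, hq₀', -⟩ := hconv.exists_seminorm (U := Set.univ) univ_mem
  have : Nonempty (CtsUltraSeminorm ℚ_[p] E) := ⟨⟨q₀, hq₀, hq₀'⟩⟩
  refine continuous_iInf_rng.2 fun β => continuous_induced_rng.2 <|
    continuous_iInf_rng.2 fun V => continuous_iInf_rng.2 fun γ => continuous_induced_rng.2 ?_
  let Δ (b : C0Space ℚ_[p] E (powWeight '' blockIndices n α)) : C(dqDomain V.carrier γ.1, E) :=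
    cAlphaDelta V γ (BlockCAlphaSpace.incl β ((mahlerLinearEquiv n α hconv hcomplete).symm b))
  suffices Continuous Δ from this
  have hγ : γ.1 ∈ blockIndices n α := blockIndices_mono β.2 fun i => Nat.cast_le.1 (γ.2 i)
  have hnull : ∀ b : C0Space ℚ_[p] E (powWeight '' blockIndices n α), WeightedNull p γ.1 b.1 :=
    fun b => mem_c0Submodule_iff.1 b.2 _ hγ
  have hΔ : ∀ b, Δ b = (hnull b).dqSum hconv hcomplete V.subset := fun b =>
    (cAlphaDelta_spec V γ _).unique V.isCartesian
      ((mem_c0Submodule_iff.1 b.2 0 zero_mem_blockIndices).isDQExtension_dqSum hconv hcomplete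
        (hnull b) V.subset)
  rw [continuous_iff_continuousAt]
  intro b₀
  rw [ContinuousAt, ContinuousMap.tendsto_iff_forall_isCompact_tendstoUniformlyOn]
  intro S _
  rw [hconv.tendstoUniformlyOn_iff]
  intro q hq hq' ε hε
  have hev := ((c0Space_withSeminorms (p := p) (E := E) _).tendsto_nhds id b₀).1 tendsto_id
    ⟨⟨_, γ.1, hγ, rfl⟩, ⟨q, hq, hq'⟩⟩ (ε / 2) (half_pos hε)
  filter_upwards [hev] with b hb x _
  rw [hΔ, hΔ]
  refine ((hnull b).seminorm_dqSum_sub_le hconv hcomplete (hnull b₀) V.subset hq hq'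
    (half_pos hε).le (fun ν => ?_) x).trans_lt (half_lt_self hε)
  exact (le_ciSup (C0Space.bddAbove (W := powWeight '' blockIndices n α)
    ⟨_, γ.1, hγ, rfl⟩ ⟨q, hq, hq'⟩ (b - b₀)) ν).trans hb.le

end Blocks

end

theorem mainTheorem6 {p : ℕ} [Fact p.Prime]
    {E : Type*} [AddCommGroup E] [Module ℚ_[p] E] [UniformSpace E] [IsUniformAddGroup E]
    [ContinuousSMul ℚ_[p] E] [T2Space E]
    (hconv : IsUltraLocallyConvex ℚ_[p] E)
    (hcomplete : ∀ u : ℕ → E, CauchySeq u → ∃ a, Tendsto u atTop (𝓝 a))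
    {l : ℕ} (hl : 0 < l) (n : Fin l → ℕ) (hn : ∀ j, 0 < n j) (α : Fin l → ℕ∞) :
    (∀ f : zpPow p (Σ j, Fin (n j)) → E, Continuous f →
      (IsBlockCAlpha α f ↔
        ∀ β ∈ blockIndices n α, ∀ q : Seminorm ℚ_[p] E, Continuous q → IsNonarchimedean q →
          Tendsto (fun ν => q (mahlerCoeff f ν) * (powWeight β ν : ℝ))
            (absAtTop (Σ j, Fin (n j))) (𝓝 0))) ∧
    ∃ A : BlockCAlphaSpace (zpPow p (Σ j, Fin (n j))) E α ≃L[ℚ_[p]]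
        C0Space ℚ_[p] E (powWeight '' blockIndices n α),
      ∀ f ν, A f ν = mahlerCoeff f ν := by
  refine ⟨fun f hf => ?_, ⟨mahlerLinearEquiv n α hconv hcomplete,
    continuous_mahlerLinearEquiv hconv hcomplete,
    continuous_mahlerLinearEquiv_symm hconv hcomplete⟩, fun f ν => rfl⟩
  rw [isBlockCAlpha_iff hconv hcomplete hf]
  exact forall₂_congr fun β _ => weightedNull_iff_tendsto
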